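/- **Setting.** Let $\mathcal A$ be an alphabet with $d\ge 2$ letters, $\pi=(\pi_0,\pi_1)$ an irreducible pair of bijections $\mathcal A\to\{1,\dots,d\}$, $\lambda\in\mathbb R_{>0}^{\mathcal A}$, $I=[0,|\lambda|)$, $|\lambda|=\sum_\alpha\lambda_\alpha$, and let $T:I\to I$ be the interval exchange (IET) translating $I_\alpha=[l_\alpha,r_\alpha)$, $l_\alpha=\sum_{\pi_0(\beta)<\pi_0(\alpha)}\lambda_\beta$, $r_\alpha=l_\alpha+\lambda_\alpha$, onto the interval of the same length with left end $\sum_{\pi_1(\beta)<\pi_1(\alpha)}\lambda_\beta$; $m_\alpha$ is the midpoint of $I_\alpha$. Assume Keane's condition: $T^m l_\alpha\ne l_\beta$ for $m\ge1$ whenever $\pi_0(\beta)\neq 1$. Let $\Omega_\pi$ be the translation matrix ($(\Omega_\pi)_{\alpha\beta}=1$ if $\pi_1(\alpha)>\pi_1(\beta)$ and $\pi_0(\alpha)<\pi_0(\beta)$; $-1$ if $\pi_1(\alpha)<\pi_1(\beta)$ and $\pi_0(\alpha)>\pi_0(\beta)$; $0$ otherwise), $H(\pi)=\Omega_\pi\mathbb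 R^{\mathcal A}$, and $g_\pi=\frac12\dim H(\pi)$. Let $\mathcal R$ be Rauzy–Veech induction: if $w$ is the last letter of the row ($\pi_0$ or $\pi_1$) whose last letter is longer and $v$ the last letter of the other row, then $\lambda_w$ is replaced by $\lambda_w-\lambda_v$ and in the other row $v$ is moved to the place right after $w$; put $A(T)=\mathrm{Id}+E_{wv}$ and $A^{(N)}(T)=A(T)A(\mathcal RT)\cdots A(\mathcal R^{N-1}T)$. For an *acceleration*, i.e. a strictly increasing sequence $0=n_0<n_1<\cdots$ of integers, let $T^{(k)}=\mathcal R^{n_k}T$, an IET of the intervals $I^{(k)}_\alpha$ of $I^{(k)}$, $Q(k,l)=A^{(n_l-n_k)}(\mathcal R^{n_k}T)^t$ for $k\le l$, $Q(k)=Q(0,k)$, $Z(k+1)=Q(k,k+1)$, $Q_\alpha(k)=\sum_\beta Q_{\alpha\beta}(k)$. Vectors carry the norm $\|h\|=\sum_\alpha|h_\alpha|$ and matrices $\|B\|=\max_\alpha\sum_\beta|B_{\alpha\beta}|$; norms of restrictions of $Q(k,l)$ to subspaces (and of their inverses) are operator norms for the vector norm. $T$ is *Oseledets generic* with exponents $\lambda_1>\dots>\lambda_{g_\pi}>\lambda_{g_\pi+1}=0$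 if there are subspaces $\{0\}=E_0\subset E_{-1}\subset\dots\subset E_{-g_\pi}\subset E_{g_\pi+1}\subset E_{g_\pi}\subset\dots\subset E_1=\mathbb R^{\mathcal A}$ with $\dim E_{-i}-\dim E_{-i+1}=\dim E_i-\dim E_{i+1}=1$ for $1\le i\le g_\pi$ such that, for the matrices $Q(n)$ of some acceleration, $\frac1n\log\|Q(n)h\|$ tends to $-\lambda_i$ for $h\in E_{-i}\setminus E_{-i+1}$, to $0$ for $h\in E_{g_\pi+1}\setminus E_{-g_\pi}$, and to $\lambda_i$ for $h\in E_i\setminus E_{i+1}$ ($1\le i\le g_\pi$). For $\tau>0$, an acceleration $(n_k)$ is an *FDC-acceleration for $\tau$* if there are $c>0$, $C,\kappa\ge1$, $\delta\in(0,1)$, natural numbers $(r_n)_{n\ge0}$ with $r_0=0$ (write $r(k,l)=\sum_{k\le j<l}r_j$) and subspaces $\{0\}=U_1\subset\dots\subset U_{g_\pi+1}\subset H(\pi)$ with $E_j\oplus U_j=\mathbb R^{\mathcal A}$ such that, with $E_j^{(k)}=Q(k)E_j$, $U_j^{(k)}=Q(k)U_j$: - for each $k\ge1$ there is $0<p\le\min_\alpha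 Q_\alpha(k)$ such that the sets $T^iI^{(k)}$, $0\le i<p$, are pairwise disjoint intervals of total length at least $\delta|I|$; - $\lim_n r(0,n)/n$ exists and lies in $(1,1+\tau)$; - $\|Q(k,l)|_{E^{(k)}_j}\|\le Ce^{(\lambda_j+\tau)r(k,l)}$ for $k<l$, $1\le j\le g_\pi+1$; - $\|(Q(k,l)|_{U^{(k)}_j})^{-1}\|\le Ce^{(-\lambda_{j-1}+\tau)r(k,l)}$ for $k<l$, $2\le j\le g_\pi+1$; - $\|Z(k+1)\|\le Ce^{\tau k}$ and $ce^{\lambda_1k}\le\|Q(k)\|\le Ce^{\lambda_1(1+\tau)k}$ for $k\ge0$; - $|I^{(k)}|\le\kappa|I^{(k)}_\alpha|$ for all $k\geq 0$ and $\alpha$; - $|\sin\angle(E^{(k)}_j,U^{(k)}_j)|\ge c\|Q(k)\|^{-\tau}$ for $k\ge0$, $2\le j\le g_\pi+1$. $T$ satisfies the *Filtration Diophantine Condition (FDC)* if it satisfies Keane's condition, is Oseledets generic, and has an FDC-acceleration for every $\tau>0$. For $0<a<1$, $\operatorname{P_aG}$ is the space of $\varphi\in C^1(\bigcup_\alpha(l_\alpha,r_\alpha))$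 such that $|\varphi'(x)|(x-l_\alpha)^{1+a}$ on $(l_\alpha,m_\alpha]$ and $|\varphi'(x)|(r_\alpha-x)^{1+a}$ on $[m_\alpha,r_\alpha)$ are bounded, the limits $C^+_\alpha=-\lim_{x\searrow l_\alpha}\varphi'(x)(x-l_\alpha)^{1+a}$ and $C^-_\alpha=\lim_{x\nearrow r_\alpha}\varphi'(x)(r_\alpha-x)^{1+a}$ exist, and $C^-_{\pi_0^{-1}(d)}C^-_{\pi_1^{-1}(d)}=0=C^+_{\pi_0^{-1}(1)}C^+_{\pi_1^{-1}(1)}$. $\operatorname{\widehat P_a}$ is the space of Borel $\varphi$ for which $|\varphi(x)|(x-l_\alpha)^a$ on $(l_\alpha,m_\alpha]$ and $|\varphi(x)|(r_\alpha-x)^a$ on $[m_\alpha,r_\alpha)$ are bounded. For $g:I\to(0,+\infty]$ with $\inf g>0$, $(T^g_t)$ is the special flow over $T$ on $I^g=\{(x,r):x\in I,\ 0\le r<g(x)\}$: $T^g_t(x,r)=(T^nx,\,r+t-g^{(n)}(x))$ with $g^{(n)}(x)\le r+t<g^{(n+1)}(x)$, where $\varphi^{(n)}=\sum_{0\le i<n}\varphi\circ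 T^i$. Put $\varphi_f(x)=\int_0^{g(x)}f(x,r)\,dr$, $S(k)\varphi=\varphi^{(Q_\beta(k))}$ on $I^{(k)}_\beta$, and let $\mathcal M^{(k)}\psi\in\mathbb R^{\mathcal A}$ be the vector of mean values of $\psi$ over the intervals $I^{(k)}_\alpha$. **Theorem.** Suppose that $T$ satisfies FDC, $0<b\le a<1$, $g:I\to(0,+\infty]$ satisfies $\inf g>0$ and $g\in\operatorname{P_aG}$, and $f:I^g\to\mathbb R$ is an integrable map such that $\varphi_f\in\operatorname{P_bG}$ and $\varphi_{|f|}\in\operatorname{\widehat P_b}$. Assume that for every $\tau>0$ there is an FDC-acceleration for $\tau$ along which $$\|\mathcal M^{(k)}(S(k)\varphi_f)\|=O\big(e^{b\lambda_1(1+\tau)k}\big)\qquad(k\to\infty).$$ Then for Lebesgue-a.e. $(x,r)\in I^g$ the function $t\mapsto f(T^g_t(x,r))$ is integrable on $[0,s]$ for every $s\ge0$, and $$\limsup_{s\to+\infty}\frac{\log\big|\int_0^sf(T^g_t(x,r))\,dt\big|}{\log s}\le b .$$ -/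

import Mathlib

open Filter Topology MeasureTheory Asymptotics

noncomputable section

/-! ### Interval exchange transformations -/

/-- Combinatorial and length data of an interval exchange of `d ≥ 2` intervals labelled by `A`:
`perm 0 α` and `perm 1 α` are the positions (counted from `0` to `d - 1`) of the interval `α`
before and after the exchange, and `len α` is its length.  Positivity of the lengths is the
separate predicate `IET.Pos`, so that Rauzy induction is a total map on such data. -/
structure IET (A : Type*) (d : ℕ) where
  two_le : 2 ≤ d
  perm : Fin 2 → A ≃ Fin d
  len : A → ℝ

namespace IET

variable {A : Type*} [Fintype A] [DecidableEq A] {d : ℕ}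

/-- All lengths are positive. -/
def Pos (T : IET A d) : Prop := ∀ α, 0 < T.len α

/-- The letter in the first position of row `ε`. -/
def first (T : IET A d) (ε : Fin 2) : A :=
  (T.perm ε).symm ⟨0, by have := T.two_le; omega⟩

/-- The letter in the last position of row `ε`. -/
def last (T : IET A d) (ε : Fin 2) : A :=
  (T.perm ε).symm ⟨d - 1, by have := T.two_le; omega⟩

/-- The total length `|I|`. -/
def total (T : IET A d) : ℝ := ∑ α, T.len α

/-- The interval `I = [0, |I|)`. -/
def base (T : IET A d) : Set ℝ := Set.Ico 0 T.total

/-- Left end of the interval `α` before (`ε = 0`) or after (`ε = 1`) the exchange. -/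
def left (T : IET A d) (ε : Fin 2) (α : A) : ℝ :=
  ∑ β with T.perm ε β < T.perm ε α, T.len β

/-- `l_α` -/
def l (T : IET A d) (α : A) : ℝ := T.left 0 α

/-- `r_α` -/
def r (T : IET A d) (α : A) : ℝ := T.left 0 α + T.len α

/-- The midpoint `m_α`. -/
def mid (T : IET A d) (α : A) : ℝ := (T.l α + T.r α) / 2

/-- `I_α = [l_α, r_α)` -/
def interval (T : IET A d) (α : A) : Set ℝ := Set.Ico (T.l α) (T.r α)

/-- The transformation: translation of each `I_α` onto the interval at its new place
(and the identity outside `I`). -/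
def map (T : IET A d) (x : ℝ) : ℝ :=
  x + ∑ α, (T.interval α).indicator (fun _ => T.left 1 α - T.left 0 α) x

/-- The pair of bijections is irreducible. -/
def Irred (T : IET A d) : Prop :=
  ∀ k : ℕ, 1 ≤ k → k < d →
    ((T.perm 0).symm.trans (T.perm 1)) '' {p : Fin d | (p : ℕ) < k} ≠ {p : Fin d | (p : ℕ) < k}

/-- Keane's condition. -/
def Keane (T : IET A d) : Prop :=
  ∀ m : ℕ, 1 ≤ m → ∀ α β : A, ((T.perm 0 β : Fin d) : ℕ) ≠ 0 → T.map^[m] (T.l α) ≠ T.l β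

/-- The translation matrix `Ω_π`. -/
def Omega (T : IET A d) : Matrix A A ℝ := fun α β =>
  if T.perm 1 β < T.perm 1 α ∧ T.perm 0 α < T.perm 0 β then 1
  else if T.perm 1 α < T.perm 1 β ∧ T.perm 0 β < T.perm 0 α then -1
  else 0

/-- `H(π) = Ω_π (ℝ^A)` -/
def H (T : IET A d) : Submodule ℝ (A → ℝ) := LinearMap.range T.Omega.mulVecLin

/-- The genus `g`: half the rank of the antisymmetric matrix `Ω_π`. -/
def genus (T : IET A d) : ℕ := Module.finrank ℝ T.H / 2

/-! ### Rauzy–Veech induction -/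

/-- The type of the induction step. -/
def rauzyType (T : IET A d) : Fin 2 :=
  if T.len (T.last 1) < T.len (T.last 0) then 0 else 1

/-- Positions up to `j` are kept, the last one moves to `j + 1`, the others move up by one. -/
def shiftFun {d : ℕ} (j p : Fin d) : Fin d :=
  if h : p ≤ j then p
  else if h' : (p : ℕ) + 1 < d then ⟨p + 1, h'⟩
  else ⟨j + 1, by have := p.2; rw [not_le, Fin.lt_def] at h; omega⟩

lemma shiftFun_injective {d : ℕ} (j : Fin d) : Function.Injective (shiftFun j) := by
  intro p q h
  have hp := p.2
  have hq := q.2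
  unfold shiftFun at h
  apply Fin.ext
  split_ifs at h with h1 h2 h3 h4 h5 h6 <;>
    simp only [Fin.ext_iff, Fin.le_def] at * <;> omega

/-- `shiftFun j` as a permutation of the positions. -/
def shiftPerm {d : ℕ} (j : Fin d) : Fin d ≃ Fin d :=
  Equiv.ofBijective (shiftFun j) (Finite.injective_iff_bijective.mp (shiftFun_injective j))

/-- One step of Rauzy–Veech induction: with `ε` the type, `w` the last letter of row `ε` and `v` the
last letter of row `1 - ε`, the letter `v` is moved in row `1 - ε` to the place right after `w`, and
`λ_w` is replaced by `λ_w - λ_v`. -/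
def rauzy (T : IET A d) : IET A d where
  two_le := T.two_le
  perm := fun η =>
    if η = T.rauzyType then T.perm η
    else (T.perm η).trans (shiftPerm (T.perm η (T.last T.rauzyType)))
  len := Function.update T.len (T.last T.rauzyType)
    (T.len (T.last T.rauzyType) - T.len (T.last (1 - T.rauzyType)))

/-- The elementary matrix `A(T) = Id + E_{w v}` of the step, so that `λ = A(T) λ̃`. -/
def rauzyMatrix (T : IET A d) : Matrix A A ℕ :=
  1 + Matrix.single (T.last T.rauzyType) (T.last (1 - T.rauzyType)) 1

/-- `A^{(N)}(T) = A(T) A(R T) ⋯ A(R^{N-1} T)` -/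
def kz (T : IET A d) : ℕ → Matrix A A ℕ
  | 0 => 1
  | N + 1 => kz T N * (rauzy^[N] T).rauzyMatrix

/-- An accelerating sequence. -/
def IsAccel (n : ℕ → ℕ) : Prop := StrictMono n ∧ n 0 = 0

/-- `T^{(k)} = R^{n_k}(T)` -/
def acc (T : IET A d) (n : ℕ → ℕ) (k : ℕ) : IET A d := rauzy^[n k] T

/-- `Q(k,l) = A^{(n_l - n_k)}(R^{n_k} T)ᵗ`, for `k ≤ l`. -/
def Q (T : IET A d) (n : ℕ → ℕ) (k l : ℕ) : Matrix A A ℕ :=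
  ((T.acc n k).kz (n l - n k)).transpose

/-- The linear map `Q(k,l) : Γ^{(k)} → Γ^{(l)}`, both spaces being identified with `ℝ^A`. -/
def Qlin (T : IET A d) (n : ℕ → ℕ) (k l : ℕ) : (A → ℝ) →ₗ[ℝ] (A → ℝ) :=
  ((T.Q n k l).map (Nat.cast : ℕ → ℝ)).mulVecLin

/-- `Z(k+1) = Q(k,k+1)`; here `Zsucc k` is `Z(k+1)`. -/
def Zsucc (T : IET A d) (n : ℕ → ℕ) (k : ℕ) : Matrix A A ℕ := T.Q n k (k + 1)

/-- The return time `Q_α(k) = ∑_β Q_{αβ}(k)`. -/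
def height (T : IET A d) (n : ℕ → ℕ) (k : ℕ) (α : A) : ℕ := ∑ β, T.Q n 0 k α β

/-- The norm of a vector: sum of the absolute values of the coefficients. -/
def vnorm (h : A → ℝ) : ℝ := ∑ α, |h α|

/-- The norm of a matrix (with nonnegative entries): the largest row sum. -/
def mnorm (B : Matrix A A ℕ) : ℝ := ((Finset.univ.sup fun α => ∑ β, B α β : ℕ) : ℝ)

/-! ### Oseledets filtrations and the Filtration Diophantine Condition -/

/-- The subspaces `E (-i)`, `0 ≤ i ≤ g`, and `E i`, `1 ≤ i ≤ g + 1` (with `E (g+1) = E_cs`) form an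
Oseledets filtration of `Γ = ℝ^A` with Lyapunov exponents `lam 1 > ⋯ > lam g > lam (g+1) = 0`,
with respect to the acceleration `m` of the Kontsevich–Zorich cocycle. -/
structure IsOseledetsFiltration (T : IET A d) (m : ℕ → ℕ) (lam : ℕ → ℝ)
    (E : ℤ → Submodule ℝ (A → ℝ)) : Prop where
  lam_lt : ∀ i : ℕ, 1 ≤ i → i ≤ T.genus → lam (i + 1) < lam i
  lam_zero : lam (T.genus + 1) = 0
  bot : E 0 = ⊥
  top : E 1 = ⊤
  neg_le : ∀ i : ℕ, i < T.genus → E (-(i : ℤ)) ≤ E (-((i : ℤ) + 1))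
  neg_le_cs : E (-(T.genus : ℤ)) ≤ E ((T.genus : ℤ) + 1)
  pos_le : ∀ i : ℕ, 1 ≤ i → i ≤ T.genus → E ((i : ℤ) + 1) ≤ E (i : ℤ)
  lim_neg : ∀ i : ℕ, 1 ≤ i → i ≤ T.genus →
    ∀ h ∈ E (-(i : ℤ)), h ∉ E (-(i : ℤ) + 1) →
      Tendsto (fun n : ℕ => Real.log (vnorm (T.Qlin m 0 n h)) / n) atTop (𝓝 (-lam i))
  lim_cs : ∀ h ∈ E ((T.genus : ℤ) + 1), h ∉ E (-(T.genus : ℤ)) →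
      Tendsto (fun n : ℕ => Real.log (vnorm (T.Qlin m 0 n h)) / n) atTop (𝓝 0)
  lim_pos : ∀ i : ℕ, 1 ≤ i → i ≤ T.genus →
    ∀ h ∈ E (i : ℤ), h ∉ E ((i : ℤ) + 1) →
      Tendsto (fun n : ℕ => Real.log (vnorm (T.Qlin m 0 n h)) / n) atTop (𝓝 (lam i))
  dim_neg : ∀ i : ℕ, 1 ≤ i → i ≤ T.genus →
    Module.finrank ℝ (E (-(i : ℤ))) = Module.finrank ℝ (E (-(i : ℤ) + 1)) + 1
  dim_pos : ∀ i : ℕ, 1 ≤ i → i ≤ T.genus →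
    Module.finrank ℝ (E (i : ℤ)) = Module.finrank ℝ (E ((i : ℤ) + 1)) + 1

/-- A filtration `0 = U 1 ⊆ ⋯ ⊆ U (g+1) ⊆ H(π)` complementary to `E 1 ⊇ ⋯ ⊇ E (g+1)`. -/
structure IsComplFiltration (T : IET A d) (E : ℤ → Submodule ℝ (A → ℝ))
    (U : ℕ → Submodule ℝ (A → ℝ)) : Prop where
  bot : U 1 = ⊥
  le_succ : ∀ j : ℕ, 1 ≤ j → j ≤ T.genus → U j ≤ U (j + 1)
  le_H : U (T.genus + 1) ≤ T.H
  compl : ∀ j : ℕ, 1 ≤ j → j ≤ T.genus + 1 → IsCompl (E (j : ℤ)) (U j)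

/-- The Rokhlin tower condition with constant `δ`: for every `k ≥ 1` the sets `T^i I^{(k)}`,
`0 ≤ i < p`, for some `0 < p ≤ min_α Q_α(k)`, are pairwise disjoint intervals of total length at
least `δ |I|`. -/
def RokhlinTowers (T : IET A d) (n : ℕ → ℕ) (δ : ℝ) : Prop :=
  ∀ k : ℕ, 1 ≤ k → ∃ p : ℕ, 0 < p ∧ (∀ α, p ≤ T.height n k α) ∧
    (∀ i < p, (T.map^[i] '' (T.acc n k).base).OrdConnected) ∧
    (∀ i < p, ∀ j < p, i ≠ j →
      Disjoint (T.map^[i] '' (T.acc n k).base) (T.map^[j] '' (T.acc n k).base)) ∧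
    δ * T.total ≤ p * (T.acc n k).total

/-- `r(k,l) = ∑_{k ≤ j < l} r_j` -/
def partialSum (ρ : ℕ → ℕ) (k l : ℕ) : ℝ := ∑ j ∈ Finset.Ico k l, (ρ j : ℝ)

/-- The quantitative requirements of the Filtration Diophantine Condition for a given `τ`,
acceleration `n`, constants, sequence `ρ` (the return times `r_n`) and complementary filtration `U`.
Norms of operators restricted to subspaces are spelled out on vectors, and the sine of
the angle between two subspaces is the infimum of the sines of the angles between
their nonzero vectors. -/
structure FDCBounds (T : IET A d) (lam : ℕ → ℝ) (E : ℤ → Submodule ℝ (A → ℝ))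
    (τ : ℝ) (n : ℕ → ℕ) (c C κ : ℝ) (ρ : ℕ → ℕ) (U : ℕ → Submodule ℝ (A → ℝ)) : Prop where
  return_lim : ∃ v : ℝ, 1 < v ∧ v < 1 + τ ∧
    Tendsto (fun N : ℕ => partialSum ρ 0 N / N) atTop (𝓝 v)
  bound_E : ∀ k l : ℕ, k < l → ∀ j : ℕ, 1 ≤ j → j ≤ T.genus + 1 →
    ∀ h ∈ (E (j : ℤ)).map (T.Qlin n 0 k),
      vnorm (T.Qlin n k l h) ≤ C * Real.exp ((lam j + τ) * partialSum ρ k l) * vnorm h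
  bound_U : ∀ k l : ℕ, k < l → ∀ j : ℕ, 2 ≤ j → j ≤ T.genus + 1 →
    ∀ h ∈ (U j).map (T.Qlin n 0 k),
      vnorm h ≤ C * Real.exp ((-lam (j - 1) + τ) * partialSum ρ k l) * vnorm (T.Qlin n k l h)
  bound_Z : ∀ k : ℕ, mnorm (T.Zsucc n k) ≤ C * Real.exp (τ * k)
  lower_Q : ∀ k : ℕ, c * Real.exp (lam 1 * k) ≤ mnorm (T.Q n 0 k)
  upper_Q : ∀ k : ℕ, mnorm (T.Q n 0 k) ≤ C * Real.exp (lam 1 * (1 + τ) * k)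
  balanced : ∀ (k : ℕ) (α : A), (T.acc n k).total / (T.acc n k).len α ≤ κ
  angle : ∀ k j : ℕ, 2 ≤ j → j ≤ T.genus + 1 →
    ∀ e ∈ (E (j : ℤ)).map (T.Qlin n 0 k), e ≠ 0 →
    ∀ u ∈ (U j).map (T.Qlin n 0 k), u ≠ 0 →
      c * mnorm (T.Q n 0 k) ^ (-τ) ≤
        |Real.sin (InnerProductGeometry.angle (WithLp.toLp 2 e : EuclideanSpace ℝ A)
          (WithLp.toLp 2 u))|

/-- `n` is an FDC-acceleration of `T` for the parameter `τ`. -/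
def IsFDCAccel (T : IET A d) (lam : ℕ → ℝ) (E : ℤ → Submodule ℝ (A → ℝ)) (τ : ℝ)
    (n : ℕ → ℕ) : Prop :=
  IsAccel n ∧ ∃ c C κ δ : ℝ, 0 < c ∧ 1 ≤ C ∧ 1 ≤ κ ∧ 0 < δ ∧ δ < 1 ∧
    ∃ (ρ : ℕ → ℕ) (U : ℕ → Submodule ℝ (A → ℝ)), ρ 0 = 0 ∧ T.IsComplFiltration E U ∧
      T.RokhlinTowers n δ ∧ T.FDCBounds lam E τ n c C κ ρ U

/-- `T` is an irreducible interval exchange satisfying Keane's condition which is Oseledets generic,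
with exponents `lam` and filtration `E`, and satisfies the Filtration Diophantine Condition. -/
structure SatisfiesFDC (T : IET A d) (lam : ℕ → ℝ) (E : ℤ → Submodule ℝ (A → ℝ)) : Prop where
  pos : T.Pos
  irred : T.Irred
  keane : T.Keane
  generic : ∃ m : ℕ → ℕ, IsAccel m ∧ T.IsOseledetsFiltration m lam E
  accel : ∀ τ : ℝ, 0 < τ → ∃ n : ℕ → ℕ, T.IsFDCAccel lam E τ n

/-! ### Functions with polynomial singularities -/

/-- `φ ∈ P_aG(⊔ I_α)`: `φ` is `C¹` on each `(l_α, r_α)` with polynomial singularities of degree at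
most `a`, of geometric type. -/
def MemPG (T : IET A d) (a : ℝ) (φ : ℝ → ℝ) : Prop :=
  (∀ α, ContDiffOn ℝ 1 φ (Set.Ioo (T.l α) (T.r α))) ∧
  (∃ K : ℝ, ∀ α,
    (∀ x ∈ Set.Ioc (T.l α) (T.mid α), |deriv φ x * (x - T.l α) ^ (1 + a)| ≤ K) ∧
    (∀ x ∈ Set.Ico (T.mid α) (T.r α), |deriv φ x * (T.r α - x) ^ (1 + a)| ≤ K)) ∧
  ∃ Cp Cm : A → ℝ,
    (∀ α, Tendsto (fun x => -(deriv φ x * (x - T.l α) ^ (1 + a))) (𝓝[>] (T.l α)) (𝓝 (Cp α))) ∧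
    (∀ α, Tendsto (fun x => deriv φ x * (T.r α - x) ^ (1 + a)) (𝓝[<] (T.r α)) (𝓝 (Cm α))) ∧
    Cm (T.last 0) * Cm (T.last 1) = 0 ∧ Cp (T.first 0) * Cp (T.first 1) = 0

/-- `φ ∈ P̂_a(⊔ I_α)`, for `0 < a < 1`. -/
def MemPhat (T : IET A d) (a : ℝ) (φ : ℝ → ℝ) : Prop :=
  (Measurable fun x : T.base => φ x) ∧
  ∃ K : ℝ, ∀ α,
    (∀ x ∈ Set.Ioc (T.l α) (T.mid α), |φ x * (x - T.l α) ^ a| ≤ K) ∧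
    (∀ x ∈ Set.Ico (T.mid α) (T.r α), |φ x * (T.r α - x) ^ a| ≤ K)

/-- A `[0,∞]`-valued function is real-valued on the open intervals `(l_α, r_α)`. -/
def FiniteInside (T : IET A d) (φ : ℝ → ENNReal) : Prop :=
  ∀ α, ∀ x ∈ Set.Ioo (T.l α) (T.r α), φ x ≠ ⊤

/-! ### Special Birkhoff sums and mean values -/

/-- The special Birkhoff sum `S(k)φ` on `I^{(k)}` (zero outside). -/
def specialSum (T : IET A d) (n : ℕ → ℕ) (k : ℕ) (φ : ℝ → ℝ) (x : ℝ) : ℝ :=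
  ∑ β, ((T.acc n k).interval β).indicator (fun y => birkhoffSum T.map φ (T.height n k β) y) x

/-- The vector of mean values of `φ` over the exchanged intervals; for `T^{(k)}` this is
`M^{(k)}(φ) ∈ Γ^{(k)} = ℝ^A`. -/
def meanProj (T : IET A d) (φ : ℝ → ℝ) (α : A) : ℝ := ⨍ x in T.interval α, φ x

/-! ### Special flows -/

/-- The fibre `{ρ : 0 ≤ ρ < g(x)}`. -/
def fiber (g : ℝ → ENNReal) (x : ℝ) : Set ℝ := {ρ | 0 ≤ ρ ∧ ENNReal.ofReal ρ < g x}

/-- The phase space `I^g`. -/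
def suspension (T : IET A d) (g : ℝ → ENNReal) : Set (ℝ × ℝ) :=
  {p | p.1 ∈ T.base ∧ p.2 ∈ fiber g p.1}

/-- The least `N` with `v < g^{(N+1)}(x)`; for `v ≥ 0` and `g` bounded away from `0` it is the
unique `N` with `g^{(N)}(x) ≤ v < g^{(N+1)}(x)`. -/
def crossings (T : IET A d) (g : ℝ → ENNReal) (x v : ℝ) : ℕ :=
  sInf {N : ℕ | ENNReal.ofReal v < birkhoffSum T.map g (N + 1) x}

/-- The special flow under the roof `g` in times `t ≥ 0`:
`T^g_t(x,ρ) = (T^N x, ρ + t - g^{(N)}(x))` where `g^{(N)}(x) ≤ ρ + t < g^{(N+1)}(x)`. -/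
def flow (T : IET A d) (g : ℝ → ENNReal) (t : ℝ) (p : ℝ × ℝ) : ℝ × ℝ :=
  (T.map^[T.crossings g p.1 (p.2 + t)] p.1,
    p.2 + t - (birkhoffSum T.map g (T.crossings g p.1 (p.2 + t)) p.1).toReal)

/-- `φ_f(x) = ∫_0^{g(x)} f(x,ρ) dρ` -/
def fiberInt (g : ℝ → ENNReal) (f : ℝ × ℝ → ℝ) (x : ℝ) : ℝ := ∫ ρ in fiber g x, f (x, ρ)

/-- `φ_{|f|}(x) = ∫_0^{g(x)} |f(x,ρ)| dρ ∈ [0,∞]` -/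
def fiberAbsInt (g : ℝ → ENNReal) (f : ℝ × ℝ → ℝ) (x : ℝ) : ENNReal :=
  ∫⁻ ρ in fiber g x, ENNReal.ofReal |f (x, ρ)|

end IET

end

noncomputable section

set_option linter.unusedSectionVars false

namespace IET

variable {A : Type*} [Fintype A] [DecidableEq A] {d : ℕ}

/-! ### The two partitions of the base -/

/-! The integral of $f$ along a flow line is cut at the returns to the base. After $N$ returns it
equals the Birkhoff sum $\varphi_f^{(N)}(x)$, up to a constant from the initial piece of fibre and
an incomplete last fibre, which contributes at most $\varphi_{|f|}(T^Nx)$ (`flow_integral_bounds`).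
Since $g$ is bounded below, $N=O(s)$ for $s\ge1$. It remains to show that for a.e. $x$ both
quantities are $O((N+1)^{b+\varepsilon})$ for every $\varepsilon>0$
(`SatisfiesFDC.ae_exists_bound`).

Rauzy induction fills $I$ by towers over the intervals $I^{(k)}_\alpha$ (`IsTower`), on whose floors
the iterates of $T$ are translations. The floors of one tower are separated by $|I^{(k)}_\alpha|$,
so summing $\varphi'$ over them costs only a convergent series: the derivative of $S(k)\varphi$ has
singularities of order $1+b$ at the ends of $I^{(k)}_\alpha$, with a constant that does not depend
on $k$ (`IsTower.hasDerivAt_birkhoffSum`). As $0<b<1$, integration shows that at $y\in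
I^{(k)}_\alpha$ the function $S(k)\varphi$ differs from its mean by at most a constant times
$\mathrm{dist}(y,\text{ends})^{-b}+|I^{(k)}_\alpha|^{-b}$ (`abs_le_abs_average_add`). The means are
$O(e^{b\lambda_1(1+\tau)k})$ by assumption, and so is $|I^{(k)}_\alpha|^{-b}$, by balance and the
upper bound on $\|Q(k)\|$.

The distance to the ends is controlled by Borel–Cantelli: for a.e. $x$ and all large $k$, the first
$\approx e^{\lambda_1k}$ points of the orbit stay $e^{-\lambda_1(1+\tau)k}$ away from the ends at
all levels $j\le k$ (`ae_eventually_notMem_nearEnds`), because $\sum_k ke^{-\lambda_1\tau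
k}<\infty$.

Finally, an orbit segment shorter than all towers of level $k$ decomposes into at most $2Ce^{\tau
k}$ special sums from each level $j<k$ (`abs_birkhoffSum_le_of_isTower`). Hence
$|\varphi^{(N)}(x)|=O(ke^{\tau k}e^{b\lambda_1(1+\tau)k})$ for $N<c_2e^{\lambda_1k}$. Taking
$k\approx\lambda_1^{-1}\log N$ and $\tau$ small gives the exponent $b+\varepsilon$. -/

/-- The interval `α` before (`ε = 0`) or after (`ε = 1`) the exchange. -/
def rowInterval (T : IET A d) (ε : Fin 2) (α : A) : Set ℝ :=
  Set.Ico (T.left ε α) (T.left ε α + T.len α)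

lemma left_nonneg {T : IET A d} (hT : T.Pos) (ε : Fin 2) (α : A) : 0 ≤ T.left ε α :=
  Finset.sum_nonneg fun β _ => (hT β).le

lemma left_add_len (T : IET A d) (ε : Fin 2) (α : A) :
    T.left ε α + T.len α = ∑ β with T.perm ε β ≤ T.perm ε α, T.len β := by
  have : (Finset.univ.filter fun β => T.perm ε β ≤ T.perm ε α) =
      insert α (Finset.univ.filter fun β => T.perm ε β < T.perm ε α) := by
    ext β
    simp [le_iff_lt_or_eq, or_comm]
  rw [this, Finset.sum_insert (by simp), left, add_comm]

lemma left_add_len_le_left {T : IET A d} (hT : T.Pos) {ε : Fin 2} {α β : A}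
    (h : T.perm ε α < T.perm ε β) : T.left ε α + T.len α ≤ T.left ε β := by
  rw [left_add_len, left]
  refine Finset.sum_le_sum_of_subset_of_nonneg ?_ fun γ _ _ => (hT γ).le
  intro γ hγ
  simp only [Finset.mem_filter, Finset.mem_univ, true_and] at hγ ⊢
  exact hγ.trans_lt h

lemma left_add_len_le_total {T : IET A d} (hT : T.Pos) (ε : Fin 2) (α : A) :
    T.left ε α + T.len α ≤ T.total := by
  rw [left_add_len, total]
  exact Finset.sum_le_sum_of_subset_of_nonneg (Finset.subset_univ _) fun γ _ _ => (hT γ).le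

lemma perm_last (T : IET A d) (ε : Fin 2) : ((T.perm ε (T.last ε) : Fin d) : ℕ) = d - 1 := by
  simp [last]

lemma perm_le_last (T : IET A d) (ε : Fin 2) (α : A) : T.perm ε α ≤ T.perm ε (T.last ε) := by
  rw [Fin.le_def, perm_last]
  have := (T.perm ε α).2
  omega

lemma left_last_add_len (T : IET A d) (ε : Fin 2) :
    T.left ε (T.last ε) + T.len (T.last ε) = T.total := by
  rw [left_add_len, total]
  congr 1
  ext β
  simp [perm_le_last]

lemma rowInterval_subset_base {T : IET A d} (hT : T.Pos) (ε : Fin 2) (α : A) :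
    T.rowInterval ε α ⊆ T.base := fun _ hx =>
  ⟨(left_nonneg hT ε α).trans hx.1, hx.2.trans_le (left_add_len_le_total hT ε α)⟩

lemma rowInterval_disjoint {T : IET A d} (hT : T.Pos) (ε : Fin 2) {α β : A} (h : α ≠ β) :
    Disjoint (T.rowInterval ε α) (T.rowInterval ε β) := by
  rw [Set.disjoint_left]
  intro x hx hx'
  rcases lt_or_gt_of_ne ((T.perm ε).injective.ne h) with h' | h'
  · exact absurd (hx.2.trans_le (left_add_len_le_left hT h')) (not_lt.2 hx'.1)
  · exact absurd (hx'.2.trans_le (left_add_len_le_left hT h')) (not_lt.2 hx.1)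

lemma eq_of_mem_rowInterval {T : IET A d} (hT : T.Pos) {ε : Fin 2} {α β : A} {x : ℝ}
    (h : x ∈ T.rowInterval ε α) (h' : x ∈ T.rowInterval ε β) : α = β := by
  by_contra hne
  exact Set.disjoint_left.1 (rowInterval_disjoint hT ε hne) h h'

lemma exists_mem_rowInterval (T : IET A d) (ε : Fin 2) {x : ℝ} (hx : x ∈ T.base) :
    ∃ α, x ∈ T.rowInterval ε α := by
  have hne : (Finset.univ.filter fun α => T.left ε α ≤ x).Nonempty := by
    refine ⟨T.first ε, ?_⟩
    have : T.left ε (T.first ε) = 0 := by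
      rw [left, Finset.sum_eq_zero]
      intro β hβ
      simp [first, Fin.lt_def] at hβ
    simp [this, hx.1]
  -- The right-most interval whose left end does not exceed `x`; the next one starts exactly where
  -- it stops.
  obtain ⟨α, hα, hmax⟩ := Finset.exists_max_image _ (T.perm ε) hne
  simp only [Finset.mem_filter, Finset.mem_univ, true_and] at hα hmax
  refine ⟨α, hα, ?_⟩
  by_cases h : ((T.perm ε α : Fin d) : ℕ) + 1 < d
  · set β := (T.perm ε).symm ⟨(T.perm ε α : Fin d) + 1, h⟩ with hβ
    have hpβ : ((T.perm ε β : Fin d) : ℕ) = (T.perm ε α : Fin d) + 1 := by simp [hβ]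
    have hl : T.left ε β = T.left ε α + T.len α := by
      rw [left_add_len, left]
      congr 1
      ext γ
      simp only [Finset.mem_filter, Finset.mem_univ, true_and, Fin.lt_def, Fin.le_def, hpβ]
      omega
    rw [← hl]
    by_contra hcon
    have := hmax β (not_lt.1 hcon)
    rw [Fin.le_def] at this
    omega
  · have : α = T.last ε := by
      apply (T.perm ε).injective
      apply Fin.ext
      rw [perm_last]
      have := (T.perm ε α).2
      omega
    rw [this, left_last_add_len]
    exact hx.2

lemma map_of_mem {T : IET A d} (hT : T.Pos) {α : A} {x : ℝ} (hx : x ∈ T.interval α) :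
    T.map x = x + (T.left 1 α - T.left 0 α) := by
  rw [map, Finset.sum_eq_single α]
  · rw [Set.indicator_of_mem hx]
  · intro β _ hβ
    rw [Set.indicator_of_notMem]
    exact fun h => hβ (eq_of_mem_rowInterval hT (ε := 0) h hx)
  · simp

lemma map_mem_rowInterval {T : IET A d} (hT : T.Pos) {α : A} {x : ℝ} (hx : x ∈ T.interval α) :
    T.map x ∈ T.rowInterval 1 α := by
  rw [map_of_mem hT hx]
  obtain ⟨h1, h2⟩ := hx
  simp only [l, r] at h1 h2
  constructor <;> linarith

lemma mapsTo_base {T : IET A d} (hT : T.Pos) : Set.MapsTo T.map T.base T.base := by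
  intro x hx
  obtain ⟨α, hα⟩ := T.exists_mem_rowInterval 0 hx
  exact rowInterval_subset_base hT 1 α (map_mem_rowInterval hT hα)

lemma injOn_base {T : IET A d} (hT : T.Pos) : Set.InjOn T.map T.base := by
  intro x hx y hy hxy
  obtain ⟨α, hα⟩ := T.exists_mem_rowInterval 0 hx
  obtain ⟨β, hβ⟩ := T.exists_mem_rowInterval 0 hy
  have h1 := map_mem_rowInterval hT hα
  have h2 := map_mem_rowInterval hT hβ
  rw [hxy] at h1
  obtain rfl := eq_of_mem_rowInterval hT h1 h2
  rw [map_of_mem hT hα, map_of_mem hT hβ] at hxy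
  linarith

lemma iterate_mem_base {T : IET A d} (hT : T.Pos) (i : ℕ) {x : ℝ} (hx : x ∈ T.base) :
    T.map^[i] x ∈ T.base := (mapsTo_base hT).iterate i hx

lemma left_mem_interval {T : IET A d} (hT : T.Pos) (α : A) : T.l α ∈ T.interval α :=
  ⟨le_rfl, by have := hT α; simp only [r, l]; linarith⟩

lemma map_left {T : IET A d} (hT : T.Pos) (α : A) : T.map (T.l α) = T.left 1 α := by
  rw [map_of_mem hT (left_mem_interval hT α), l]
  ring

/-! ### One step of Rauzy induction -/

/-- The interval of a common last letter would be translated by zero, so its left end would be a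
fixed point of `T`, a connection. -/
lemma Keane.last_ne {T : IET A d} (hK : T.Keane) (hT : T.Pos) : T.last 0 ≠ T.last 1 := by
  intro h
  have h0 := T.left_last_add_len 0
  have h1 := T.left_last_add_len 1
  refine hK 1 le_rfl (T.last 0) (T.last 0) ?_ ?_
  · rw [perm_last]
    have := T.two_le
    omega
  · rw [Function.iterate_one, map_left hT, l]
    rw [← h] at h1
    linarith

/-- With equal lengths, `T` would send the left end of the interval of `T.last 1` to that of `T.last
0`. -/
lemma Keane.len_last_ne {T : IET A d} (hK : T.Keane) (hT : T.Pos) :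
    T.len (T.last 0) ≠ T.len (T.last 1) := by
  intro h
  have h0 := T.left_last_add_len 0
  have h1 := T.left_last_add_len 1
  refine hK 1 le_rfl (T.last 1) (T.last 0) ?_ ?_
  · rw [perm_last]
    have := T.two_le
    omega
  · rw [Function.iterate_one, map_left hT, l]
    linarith

/-- The longer of the two last letters. -/
def winner (T : IET A d) : A := T.last T.rauzyType

/-- The shorter of the two last letters. -/
def loser (T : IET A d) : A := T.last (1 - T.rauzyType)

lemma rauzyType_cases (T : IET A d) :
    T.rauzyType = 0 ∧ T.winner = T.last 0 ∧ T.loser = T.last 1 ∧ 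
        T.len (T.last 1) < T.len (T.last 0) ∨
      T.rauzyType = 1 ∧ T.winner = T.last 1 ∧ T.loser = T.last 0 ∧
        T.len (T.last 0) ≤ T.len (T.last 1) := by
  by_cases h : T.len (T.last 1) < T.len (T.last 0)
  · have : T.rauzyType = 0 := by simp [rauzyType, h]
    exact Or.inl ⟨this, by rw [winner, this], by rw [loser, this]; rfl, h⟩
  · have : T.rauzyType = 1 := by simp [rauzyType, h]
    exact Or.inr ⟨this, by rw [winner, this], by rw [loser, this]; rfl, not_lt.1 h⟩

lemma Keane.winner_ne_loser {T : IET A d} (hK : T.Keane) (hT : T.Pos) : T.winner ≠ T.loser := by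
  rcases T.rauzyType_cases with ⟨-, h1, h2, -⟩ | ⟨-, h1, h2, -⟩ <;> rw [h1, h2]
  · exact hK.last_ne hT
  · exact (hK.last_ne hT).symm

lemma Keane.len_loser_lt {T : IET A d} (hK : T.Keane) (hT : T.Pos) :
    T.len T.loser < T.len T.winner := by
  rcases T.rauzyType_cases with ⟨-, h1, h2, h⟩ | ⟨-, h1, h2, h⟩ <;> rw [h1, h2]
  · exact h
  · exact lt_of_le_of_ne h (hK.len_last_ne hT)

lemma rauzy_len (T : IET A d) (α : A) :
    T.rauzy.len α = T.len α - if α = T.winner then T.len T.loser else 0 := by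
  by_cases h : α = T.winner
  · rw [if_pos h, h]
    simp [rauzy, winner, loser]
  · rw [if_neg h, sub_zero]
    exact Function.update_of_ne h _ _

lemma Keane.rauzy_pos {T : IET A d} (hK : T.Keane) (hT : T.Pos) : T.rauzy.Pos := by
  intro α
  rw [rauzy_len]
  split_ifs with h
  · rw [h]
    linarith [hK.len_loser_lt hT]
  · linarith [hT α]

lemma rauzy_total (T : IET A d) : T.rauzy.total = T.total - T.len T.loser := by
  simp [total, rauzy_len, Finset.sum_sub_distrib]

/-- In its own row the shortened letter is the last one, so its length enters no left end. -/
lemma rauzy_left_type (T : IET A d) (α : A) :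
    T.rauzy.left T.rauzyType α = T.left T.rauzyType α := by
  have hp : T.rauzy.perm T.rauzyType = T.perm T.rauzyType := by simp [rauzy]
  simp only [left, hp]
  refine Finset.sum_congr rfl fun β hβ => ?_
  simp only [Finset.mem_filter, Finset.mem_univ, true_and] at hβ
  rw [rauzy_len, if_neg, sub_zero]
  rintro rfl
  exact absurd (T.perm_le_last T.rauzyType α) (not_le.2 hβ)

lemma rauzy_perm_other (T : IET A d) (h : T.winner ≠ T.loser) {η : Fin 2} (hη : η = 1 - T.rauzyType)
    (β : A) :
    ((T.rauzy.perm η β : Fin d) : ℕ) = 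
      if β = T.loser then ((T.perm η T.winner : Fin d) : ℕ) + 1
      else if T.perm η β ≤ T.perm η T.winner then ((T.perm η β : Fin d) : ℕ)
      else ((T.perm η β : Fin d) : ℕ) + 1 := by
  have hne : η ≠ T.rauzyType := by
    rcases T.rauzyType_cases with ⟨h, -⟩ | ⟨h, -⟩ <;> rw [hη, h] <;> decide
  have hp : T.rauzy.perm η β = shiftFun (T.perm η T.winner) (T.perm η β) := by
    simp [rauzy, hne, winner, shiftPerm]
  have hl : ((T.perm η T.loser : Fin d) : ℕ) = d - 1 := by rw [loser, ← hη, perm_last]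
  have hw : ((T.perm η T.winner : Fin d) : ℕ) ≠ d - 1 := by
    rw [← hl]
    exact fun h' => h ((T.perm η).injective (Fin.ext h'))
  have hw2 := (T.perm η T.winner).2
  have hβ2 := (T.perm η β).2
  rw [hp, shiftFun]
  by_cases hβ : β = T.loser
  · subst hβ
    have h1 : ¬ T.perm η T.loser ≤ T.perm η T.winner := by rw [Fin.le_def]; omega
    rw [if_pos rfl, dif_neg h1, dif_neg (by omega)]
  · rw [if_neg hβ]
    have hβ3 : ((T.perm η β : Fin d) : ℕ) ≠ d - 1 := by
      rw [← hl]
      exact fun h' => hβ ((T.perm η).injective (Fin.ext h'))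
    split_ifs with h1 h2
    · rfl
    · rfl
    · omega

/-- To the right of the winner two changes cancel: the winner loses the length of the loser, and the
loser is inserted just after it. The two correction terms of `key` record this summand by summand.
-/
lemma rauzy_left_other (T : IET A d) (h : T.winner ≠ T.loser) {η : Fin 2}
    (hη : η = 1 - T.rauzyType) {α : A} (hα : α ≠ T.loser) : T.rauzy.left η α = T.left η α := by
  have key : ∀ β, (if T.rauzy.perm η β < T.rauzy.perm η α then T.rauzy.len β else 0) =
      (if T.perm η β < T.perm η α then T.len β else 0) -
      (if β = T.winner then if T.perm η T.winner < T.perm η α then T.len T.loser else 0 else 0) +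
      (if β = T.loser then if T.perm η T.winner < T.perm η α then T.len T.loser else 0 else 0) := by
    intro β
    have hα' := T.rauzy_perm_other h hη α
    have hβ' := T.rauzy_perm_other h hη β
    have hl : ((T.perm η T.loser : Fin d) : ℕ) = d - 1 := by rw [loser, ← hη, perm_last]
    have hα2 := (T.perm η α).2
    rw [if_neg hα] at hα'
    rw [rauzy_len]
    simp only [Fin.lt_def, Fin.le_def] at *
    by_cases hβ : β = T.loser
    · subst hβ
      rw [if_pos rfl] at hβ'
      rw [if_neg h.symm, if_neg h.symm, if_pos rfl]
      split_ifs at * <;> first | omega | ring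
    · rw [if_neg hβ] at hβ'
      by_cases hw : β = T.winner
      · subst hw
        simp only [hβ, if_true, if_false]
        split_ifs at * <;> first | omega | ring
      · simp only [hβ, hw, if_false]
        split_ifs at * <;> first | omega | ring
  simp only [left, Finset.sum_filter]
  rw [Finset.sum_congr rfl fun β _ => key β]
  simp [Finset.sum_add_distrib, Finset.sum_sub_distrib]

/-- In this row the loser takes over the right-hand piece, of its own length, of the old interval of
the winner. -/
lemma rauzy_left_loser (T : IET A d) (h : T.winner ≠ T.loser) {η : Fin 2}
    (hη : η = 1 - T.rauzyType) :
    T.rauzy.left η T.loser = T.left η T.winner + T.len T.winner - T.len T.loser := by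
  have key : ∀ β, (if T.rauzy.perm η β < T.rauzy.perm η T.loser then T.rauzy.len β else 0) =
      (if T.perm η β < T.perm η T.winner then T.len β else 0) +
      (if β = T.winner then T.len T.winner - T.len T.loser else 0) := by
    intro β
    have hα' := T.rauzy_perm_other h hη T.loser
    have hβ' := T.rauzy_perm_other h hη β
    have hl : ((T.perm η T.loser : Fin d) : ℕ) = d - 1 := by rw [loser, ← hη, perm_last]
    have hα2 := (T.perm η T.winner).2
    rw [if_pos rfl] at hα'
    rw [rauzy_len]
    by_cases hβ : β = T.loser
    · subst hβ
      rw [if_neg h.symm, if_neg h.symm, if_neg (lt_irrefl _), if_neg]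
      · ring
      · rw [Fin.lt_def]; omega
    · rw [if_neg hβ] at hβ'
      by_cases hw : β = T.winner
      · subst hw
        simp only [if_true]
        rw [if_pos le_rfl] at hβ'
        rw [if_pos, if_neg (lt_irrefl _)]
        · ring
        · rw [Fin.lt_def]; omega
      · have hne : ((T.perm η β : Fin d) : ℕ) ≠ (T.perm η T.winner : Fin d) :=
          fun h' => hw ((T.perm η).injective (Fin.ext h'))
        simp only [Fin.lt_def, Fin.le_def] at *
        simp only [hw, if_false]
        split_ifs at * <;> first | omega | ring
  simp only [left, Finset.sum_filter]
  rw [Finset.sum_congr rfl fun β _ => key β]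
  simp [Finset.sum_add_distrib]
  ring

lemma rauzy_left_of_ne (T : IET A d) (h : T.winner ≠ T.loser) (ε : Fin 2) {α : A}
    (hα : α ≠ T.loser) : T.rauzy.left ε α = T.left ε α := by
  by_cases hε : ε = T.rauzyType
  · rw [hε, rauzy_left_type]
  · refine T.rauzy_left_other h ?_ hα
    rcases T.rauzyType_cases with ⟨h, -⟩ | ⟨h, -⟩ <;> rw [h] at hε ⊢ <;> omega

lemma rauzy_base_subset {T : IET A d} (hT : T.Pos) : T.rauzy.base ⊆ T.base :=
  Set.Ico_subset_Ico_right (by rw [rauzy_total]; linarith [hT T.loser])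

lemma Keane.rauzy_map_of_ne {T : IET A d} (hK : T.Keane) (hT : T.Pos) {α : A} (hα : α ≠ T.loser)
    {x : ℝ} (hx : x ∈ T.rauzy.interval α) : x ∈ T.interval α ∧ T.rauzy.map x = T.map x := by
  have hw := hK.winner_ne_loser hT
  have hmem : x ∈ T.interval α := by
    obtain ⟨h1, h2⟩ := hx
    simp only [l, r, T.rauzy_left_of_ne hw 0 hα] at h1 h2
    refine ⟨h1, h2.trans_le ?_⟩
    rw [rauzy_len]
    simp only [r]
    split_ifs <;> linarith [hT T.loser]
  refine ⟨hmem, ?_⟩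
  rw [map_of_mem (hK.rauzy_pos hT) hx, map_of_mem hT hmem, T.rauzy_left_of_ne hw 0 hα,
    T.rauzy_left_of_ne hw 1 hα]

/-- Over the interval of the losing letter, the induced map is the second iterate, passing through
the part of the base which is cut off. -/
lemma Keane.rauzy_map_loser {T : IET A d} (hK : T.Keane) (hT : T.Pos) :
    ∃ α β : A, (α = T.loser ∧ β = T.winner ∨ α = T.winner ∧ β = T.loser) ∧
      (∀ x ∈ T.rauzy.interval T.loser, x ∈ T.interval α ∧ T.map x ∈ T.interval β ∧
        T.rauzy.map x = T.map (T.map x) ∧ T.map x ∉ T.rauzy.base) ∧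
      ∀ y ∈ T.base, y ∉ T.rauzy.base →
        y ∈ T.interval β ∧ ∃ z ∈ T.rauzy.interval T.loser, T.map z = y := by
  have hw := hK.winner_ne_loser hT
  have hlt := hK.len_loser_lt hT
  have hP := hK.rauzy_pos hT
  have hl0 := T.left_last_add_len 0
  have hl1 := T.left_last_add_len 1
  have hlen : T.rauzy.len T.loser = T.len T.loser := by rw [rauzy_len, if_neg hw.symm, sub_zero]
  have hcut : ∀ y ∈ T.base, y ∉ T.rauzy.base → T.total - T.len T.loser ≤ y ∧ y < T.total := by
    intro y hy hy'
    rw [base, rauzy_total] at hy'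
    exact ⟨not_lt.1 fun h => hy' ⟨hy.1, h⟩, hy.2⟩
  have hnot : ∀ y, T.total - T.len T.loser ≤ y → y ∉ T.rauzy.base := by
    intro y hy hy'
    rw [base, rauzy_total] at hy'
    exact absurd hy'.2 (not_lt.2 hy)
  rcases T.rauzyType_cases with ⟨ht, h0, h1, -⟩ | ⟨ht, h1, h0, -⟩
  -- Top letter wins: `T` carries the loser's interval onto the part cut off, which lies inside the
  -- winner's interval.
  · rw [← h0] at hl0
    rw [← h1] at hl1
    have hL0 : T.rauzy.left 0 T.loser = T.left 0 T.loser := by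
      have := T.rauzy_left_type T.loser
      rwa [ht] at this
    have hL1 := T.rauzy_left_loser hw (η := 1) (by rw [ht]; rfl)
    refine ⟨T.loser, T.winner, Or.inl ⟨rfl, rfl⟩, fun x hx => ?_, fun y hy hy' => ?_⟩
    · have hm := map_of_mem hP hx
      simp only [interval, l, r, Set.mem_Ico, hL0, hlen] at hx
      have hx1 : x ∈ T.interval T.loser := hx
      have hmx := map_of_mem hT hx1
      have hx2 : T.map x ∈ T.interval T.winner := by
        rw [hmx]
        simp only [interval, l, r, Set.mem_Ico]
        constructor <;> linarith
      refine ⟨hx1, hx2, ?_, hnot _ ?_⟩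
      · rw [hm, map_of_mem hT hx2, hmx]
        linarith
      · rw [hmx]
        linarith
    · obtain ⟨hy1, hy2⟩ := hcut y hy hy'
      refine ⟨⟨by simp only [l]; linarith, by simp only [r]; linarith⟩,
        y - (T.left 1 T.loser - T.left 0 T.loser), ?_, ?_⟩
      · simp only [interval, l, r, Set.mem_Ico, hL0, hlen]
        constructor <;> linarith
      · rw [map_of_mem hT (α := T.loser), sub_add_cancel]
        simp only [interval, l, r, Set.mem_Ico]
        constructor <;> linarith
  -- Bottom letter wins: the part cut off is the loser's old interval, and `T` carries onto it the
  -- right-hand piece of the winner's interval.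
  · rw [← h0] at hl0
    rw [← h1] at hl1
    have hL1 : T.rauzy.left 1 T.loser = T.left 1 T.loser := by
      have := T.rauzy_left_type T.loser
      rwa [ht] at this
    have hL0 := T.rauzy_left_loser hw (η := 0) (by rw [ht]; rfl)
    refine ⟨T.winner, T.loser, Or.inr ⟨rfl, rfl⟩, fun x hx => ?_, fun y hy hy' => ?_⟩
    · have hm := map_of_mem hP hx
      simp only [interval, l, r, Set.mem_Ico, hL0, hlen] at hx
      have hx1 : x ∈ T.interval T.winner := by
        simp only [interval, l, r, Set.mem_Ico]
        constructor <;> linarith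
      have hmx := map_of_mem hT hx1
      have hx2 : T.map x ∈ T.interval T.loser := by
        rw [hmx]
        simp only [interval, l, r, Set.mem_Ico]
        constructor <;> linarith
      refine ⟨hx1, hx2, ?_, hnot _ ?_⟩
      · rw [hm, map_of_mem hT hx2, hmx]
        linarith
      · rw [hmx]
        linarith
    · obtain ⟨hy1, hy2⟩ := hcut y hy hy'
      refine ⟨⟨by simp only [l]; linarith, by simp only [r]; linarith⟩,
        y - (T.left 1 T.winner - T.left 0 T.winner), ?_, ?_⟩
      · simp only [interval, l, r, Set.mem_Ico, hL0, hlen]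
        constructor <;> linarith
      · rw [map_of_mem hT (α := T.winner), sub_add_cancel]
        simp only [interval, l, r, Set.mem_Ico]
        constructor <;> linarith

lemma exists_iterate_eq_of_forall {X : Type*} {F G : X → X} {s : Set X} (hG : Set.MapsTo G s s)
    (h : ∀ x ∈ s, ∃ k, 1 ≤ k ∧ G x = F^[k] x) (m : ℕ) :
    ∀ x ∈ s, ∃ M, m ≤ M ∧ G^[m] x = F^[M] x := by
  induction m with
  | zero => exact fun x _ => ⟨0, le_rfl, rfl⟩
  | succ m ih =>
    intro x hx
    obtain ⟨k, hk, hk'⟩ := h x hx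
    obtain ⟨M, hM, hM'⟩ := ih (G x) (hG hx)
    refine ⟨M + k, by omega, ?_⟩
    rw [Function.iterate_succ_apply, hM', hk', Function.iterate_add_apply]

/-- A connection for the induced map would be one for `T`: its orbits are subsequences of
`T`-orbits, and its only possibly new discontinuity is sent by `T` to an old one. -/
lemma Keane.rauzy {T : IET A d} (hK : T.Keane) (hT : T.Pos) : T.rauzy.Keane := by
  have hP := hK.rauzy_pos hT
  have hw := hK.winner_ne_loser hT
  obtain ⟨a, b, -, hab, -⟩ := hK.rauzy_map_loser hT
  have hstep : ∀ x ∈ T.rauzy.base, ∃ k, 1 ≤ k ∧ T.rauzy.map x = T.map^[k] x := by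
    intro x hx
    obtain ⟨α, hα⟩ := T.rauzy.exists_mem_rowInterval 0 hx
    by_cases h : α = T.loser
    · subst h
      exact ⟨2, by norm_num, (hab x hα).2.2.1⟩
    · exact ⟨1, le_rfl, (hK.rauzy_map_of_ne hT h hα).2⟩
  have hit := exists_iterate_eq_of_forall (mapsTo_base hP) hstep
  have hbase : ∀ α, T.rauzy.l α ∈ T.rauzy.base := fun α =>
    rowInterval_subset_base hP 0 α (left_mem_interval hP α)
  have hd := T.two_le
  have hlose : T.rauzyType = 1 → T.map (T.rauzy.l T.loser) = T.l T.loser ∧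
      ((T.perm 0 T.loser : Fin d) : ℕ) ≠ 0 := by
    intro ht
    have hL0 := T.rauzy_left_loser hw (η := 0) (by rw [ht]; rfl)
    rcases T.rauzyType_cases with ⟨ht', -⟩ | ⟨-, h1, h0, -⟩
    · rw [ht] at ht'
      exact absurd ht' (by decide)
    have hl0 := T.left_last_add_len 0
    have hl1 := T.left_last_add_len 1
    rw [← h0] at hl0
    rw [← h1] at hl1
    refine ⟨?_, by rw [h0, perm_last]; omega⟩
    have hlt := hK.len_loser_lt hT
    have hpos := hT T.loser
    rw [map_of_mem hT (α := T.winner)]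
    · simp only [l, hL0]
      linarith
    · simp only [interval, l, r, Set.mem_Ico, hL0]
      constructor <;> linarith
  -- A new left end reaches `T.l T.loser` after one step of `T`, while its first induced step is
  -- `T.map` twice; so its induced orbit lies in the forward orbit of an old left end.
  have hsource : ∀ α m, 1 ≤ m → ∃ M δ, 1 ≤ M ∧ T.rauzy.map^[m] (T.rauzy.l α) =
      T.map^[M] (T.l δ) := by
    intro α m hm
    by_cases h : T.rauzy.l α = T.l α
    · obtain ⟨M, hM, hM'⟩ := hit m _ (hbase α)
      exact ⟨M, α, hm.trans hM, by rw [hM', h]⟩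
    · have hα : α = T.loser := by
        by_contra hα
        exact h (T.rauzy_left_of_ne hw 0 hα)
      have ht : T.rauzyType = 1 := by
        by_contra ht
        have h0 : T.rauzyType = 0 := by omega
        apply h
        have := T.rauzy_left_type α
        rwa [h0] at this
      subst hα
      obtain ⟨m, rfl⟩ : ∃ k, m = k + 1 := ⟨m - 1, by omega⟩
      obtain ⟨M, hM, hM'⟩ := hit m _ (mapsTo_base hP (hbase T.loser))
      refine ⟨M + 1, T.loser, by omega, ?_⟩
      rw [Function.iterate_succ_apply, hM', (hab _ (left_mem_interval hP _)).2.2.1, (hlose ht).1,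
        Function.iterate_succ_apply]
  -- Every new discontinuity lies on the backward orbit, of length at most one, of an old one.
  have htarget : ∀ β, ((T.rauzy.perm 0 β : Fin d) : ℕ) ≠ 0 → ∃ i γ,
      ((T.perm 0 γ : Fin d) : ℕ) ≠ 0 ∧ T.map^[i] (T.rauzy.l β) = T.l γ := by
    intro β hβ
    by_cases ht : T.rauzyType = 0
    · refine ⟨0, β, ?_, ?_⟩
      · have : T.rauzy.perm 0 = T.perm 0 := by simp [IET.rauzy, ht]
        rwa [this] at hβ
      · have := T.rauzy_left_type β
        rwa [ht] at this
    · have ht1 : T.rauzyType = 1 := by omega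
      by_cases h : β = T.loser
      · subst h
        exact ⟨1, T.loser, (hlose ht1).2, (hlose ht1).1⟩
      · refine ⟨0, β, fun h0 => hβ ?_, T.rauzy_left_of_ne hw 0 h⟩
        rw [T.rauzy_perm_other hw (by rw [ht1]; rfl), if_neg h, if_pos, h0]
        rw [Fin.le_def, h0]
        exact Nat.zero_le _
  intro m hm α β hβ heq
  obtain ⟨M, δ, hM, hM'⟩ := hsource α m hm
  obtain ⟨i, γ, hγ, hi⟩ := htarget β hβ
  refine hK (i + M) (by omega) δ γ hγ ?_
  rw [Function.iterate_add_apply, ← hM', heq, hi]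

/-! ### Towers over induced maps -/

/-- `S` is the map induced by `T` on a shorter interval, with return times `q`, and the base of `T`
is filled by the towers of height `q α` over the intervals of `S`, on the floors of which the
iterates of `T` are translations. -/
structure IsTower (T S : IET A d) (q : A → ℕ) : Prop where
  base_subset : S.base ⊆ T.base
  pos : ∀ α, 0 < q α
  ret : ∀ α, ∀ x ∈ S.interval α, S.map x = T.map^[q α] x
  floor : ∀ α, ∀ i < q α, ∃ γ, ∃ c : ℝ, ∀ x ∈ S.interval α,
    T.map^[i] x = x + c ∧ T.map^[i] x ∈ T.interval γ
  first : ∀ α, ∀ x ∈ S.interval α, ∀ i, 0 < i → i < q α → T.map^[i] x ∉ S.base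
  cover : ∀ x ∈ T.base, ∃ α, ∃ y ∈ S.interval α, ∃ i < q α, T.map^[i] y = x
  total_eq : ∑ α, q α * S.len α = T.total

lemma isTower_refl (T : IET A d) : IsTower T T fun _ => 1 where
  base_subset := subset_rfl
  pos := fun _ => one_pos
  ret := fun _ _ _ => rfl
  floor := by
    intro α i hi
    obtain rfl : i = 0 := by omega
    exact ⟨α, 0, fun x hx => ⟨by simp, hx⟩⟩
  first := fun _ _ _ i h0 h1 => by omega
  cover := by
    intro x hx
    obtain ⟨α, hα⟩ := T.exists_mem_rowInterval 0 hx
    exact ⟨α, x, hα, 0, one_pos, rfl⟩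
  total_eq := by simp [total]

/-- One induction step is cutting and stacking: over the loser's new interval, the tower over `b` is
placed on top of the tower over `a`. -/
lemma IsTower.rauzy {T S : IET A d} {q : A → ℕ} (h : IsTower T S q) (hS : S.Pos) (hK : S.Keane) :
    IsTower T S.rauzy fun α => q α + if α = S.loser then q S.winner else 0 := by
  have hw := hK.winner_ne_loser hS
  obtain ⟨a, b, hq, hab, hcut⟩ := hK.rauzy_map_loser hS
  have hqab : q S.loser + q S.winner = q a + q b := by
    rcases hq with ⟨rfl, rfl⟩ | ⟨rfl, rfl⟩ <;> omega
  have hsub := rauzy_base_subset hS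
  refine ⟨hsub.trans h.base_subset, fun α => Nat.add_pos_left (h.pos α) _, ?_, ?_, ?_, ?_, ?_⟩
  · intro α x hx
    by_cases hα : α = S.loser
    · subst hα
      obtain ⟨h1, h2, h3, -⟩ := hab x hx
      rw [if_pos rfl, hqab, h3, h.ret b _ h2, h.ret a x h1, ← Function.iterate_add_apply, add_comm]
    · obtain ⟨h1, h2⟩ := hK.rauzy_map_of_ne hS hα hx
      rw [if_neg hα, add_zero, h2, h.ret α x h1]
  · intro α i hi
    by_cases hα : α = S.loser
    · subst hα
      rw [if_pos rfl, hqab] at hi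
      by_cases hia : i < q a
      · obtain ⟨γ, c, hc⟩ := h.floor a i hia
        exact ⟨γ, c, fun x hx => hc x (hab x hx).1⟩
      · obtain ⟨γ, c, hc⟩ := h.floor b (i - q a) (by omega)
        refine ⟨γ, c + (S.left 1 a - S.left 0 a), fun x hx => ?_⟩
        obtain ⟨h1, h2, -⟩ := hab x hx
        have := hc _ h2
        have e : T.map^[i] x = T.map^[i - q a] (S.map x) := by
          rw [h.ret a x h1, ← Function.iterate_add_apply, Nat.sub_add_cancel (not_lt.1 hia)]
        rw [← e] at this
        refine ⟨?_, this.2⟩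
        rw [this.1, map_of_mem hS h1]
        ring
    · rw [if_neg hα, add_zero] at hi
      obtain ⟨γ, c, hc⟩ := h.floor α i hi
      exact ⟨γ, c, fun x hx => hc x (hK.rauzy_map_of_ne hS hα hx).1⟩
  · intro α x hx i h0 hi
    by_cases hα : α = S.loser
    · subst hα
      rw [if_pos rfl, hqab] at hi
      obtain ⟨h1, h2, -, h4⟩ := hab x hx
      by_cases hia : i < q a
      · exact fun hmem => h.first a x h1 i h0 hia (hsub hmem)
      · have e : T.map^[i] x = T.map^[i - q a] (S.map x) := by
          rw [h.ret a x h1, ← Function.iterate_add_apply, Nat.sub_add_cancel (not_lt.1 hia)]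
        rw [e]
        rcases Nat.eq_zero_or_pos (i - q a) with hz | hz
        · rwa [hz]
        · exact fun hmem => h.first b _ h2 _ hz (by omega) (hsub hmem)
    · rw [if_neg hα, add_zero] at hi
      exact fun hmem => h.first α x (hK.rauzy_map_of_ne hS hα hx).1 i h0 hi (hsub hmem)
  · intro x hx
    obtain ⟨α, y, hy, i, hi, hxy⟩ := h.cover x hx
    by_cases hyS : y ∈ S.rauzy.base
    · obtain ⟨β, hβ⟩ := S.rauzy.exists_mem_rowInterval 0 hyS
      refine ⟨β, y, hβ, i, ?_, hxy⟩
      by_cases hβl : β = S.loser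
      · subst hβl
        obtain rfl := eq_of_mem_rowInterval hS (ε := 0) hy (hab y hβ).1
        rw [if_pos rfl, hqab]
        omega
      · obtain rfl := eq_of_mem_rowInterval hS (ε := 0) hy (hK.rauzy_map_of_ne hS hβl hβ).1
        omega
    -- Points over the removed part of the base are now in the upper part of the loser's tower.
    · obtain ⟨hyb, z, hz, hzy⟩ := hcut y (rowInterval_subset_base hS 0 α hy) hyS
      obtain rfl := eq_of_mem_rowInterval hS (ε := 0) hy hyb
      refine ⟨S.loser, z, hz, i + q a, by rw [if_pos rfl, hqab]; omega, ?_⟩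
      rw [Function.iterate_add_apply, ← h.ret a z (hab z hz).1, hzy, hxy]
  · rw [← h.total_eq]
    have : ∀ α, ((q α + if α = S.loser then q S.winner else 0 : ℕ) : ℝ) * S.rauzy.len α =
        q α * S.len α - (if α = S.winner then q S.winner * S.len S.loser else 0) +
          (if α = S.loser then q S.winner * S.len S.loser else 0) := by
      intro α
      rw [rauzy_len]
      by_cases h1 : α = S.loser
      · subst h1
        simp [hw.symm]
        ring
      · by_cases h2 : α = S.winner
        · subst h2
          simp [h1]
          ring
        · simp [h1, h2]
    rw [Finset.sum_congr rfl fun α _ => this α]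
    simp [Finset.sum_add_distrib, Finset.sum_sub_distrib]

lemma Keane.rauzy_iterate {T : IET A d} (hK : T.Keane) (hT : T.Pos) (N : ℕ) :
    (IET.rauzy^[N] T).Pos ∧ (IET.rauzy^[N] T).Keane := by
  induction N with
  | zero => exact ⟨hT, hK⟩
  | succ N ih =>
    rw [Function.iterate_succ_apply']
    exact ⟨ih.2.rauzy_pos ih.1, ih.2.rauzy ih.1⟩

/-- Right multiplication by $\mathrm{Id}+E_{wv}$ adds column $w$ to column $v$. Column sums thus
follow the same recursion as tower heights in `IsTower.rauzy`. -/
lemma sum_kz_succ (T : IET A d) (N : ℕ) (α : A) : ∑ β, T.kz (N + 1) β α =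
    ∑ β, T.kz N β α + if α = (IET.rauzy^[N] T).loser then
      ∑ β, T.kz N β (IET.rauzy^[N] T).winner else 0 := by
  have : ∀ β, T.kz (N + 1) β α = T.kz N β α +
      if α = (IET.rauzy^[N] T).loser then T.kz N β (IET.rauzy^[N] T).winner else 0 := by
    intro β
    simp only [kz, rauzyMatrix, Matrix.mul_add, Matrix.mul_one, Matrix.add_apply]
    congr 1
    change (T.kz N * Matrix.single (IET.rauzy^[N] T).winner (IET.rauzy^[N] T).loser 1 :
      Matrix A A ℕ) β α = _
    split_ifs with h
    · rw [h, Matrix.mul_single_apply_same, mul_one]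
    · rw [Matrix.mul_single_apply_of_ne _ _ _ _ _ h]
  rw [Finset.sum_congr rfl fun β _ => this β, Finset.sum_add_distrib]
  congr 1
  split_ifs <;> simp

lemma Keane.isTower_rauzy_iterate {T : IET A d} (hK : T.Keane) (hT : T.Pos) (N : ℕ) :
    IsTower T (IET.rauzy^[N] T) fun α => ∑ β, T.kz N β α := by
  induction N with
  | zero =>
    have : (fun α => ∑ β, T.kz 0 β α) = fun _ => 1 := by
      funext α
      simp [kz, Matrix.one_apply]
    rw [this]
    exact T.isTower_refl
  | succ N ih =>
    obtain ⟨h1, h2⟩ := hK.rauzy_iterate hT N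
    have := ih.rauzy h1 h2
    rw [← Function.iterate_succ_apply' IET.rauzy] at this
    convert this using 2 with α
    exact T.sum_kz_succ N α

/-- Each step adds the winner's height, at least one. This makes the matrices unbounded, which later
forces $\lambda_1>0$. -/
lemma Keane.le_sum_kz {T : IET A d} (hK : T.Keane) (hT : T.Pos) (N : ℕ) :
    N ≤ ∑ α, ∑ β, T.kz N β α := by
  induction N with
  | zero => exact Nat.zero_le _
  | succ N ih =>
    have := (hK.isTower_rauzy_iterate hT N).pos (IET.rauzy^[N] T).winner
    simp only [sum_kz_succ, Finset.sum_add_distrib, Finset.sum_ite_eq', Finset.mem_univ, if_true]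
    omega

/-! ### Splitting orbit segments along the levels of the induction -/

/-- A segment between two points of `S.base` is a chain of complete passages through towers. The
bound `B` is asked only at the orbit points concerned, since special sums may be unbounded near the
ends. -/
lemma IsTower.exists_visits {T S : IET A d} {q : A → ℕ} (h : IsTower T S q) (hS : S.Pos)
    {φ : ℝ → ℝ} {B : ℝ} (n : ℕ) : ∀ y ∈ S.base, T.map^[n] y ∈ S.base →
      (∀ t < n, ∀ α, T.map^[t] y ∈ S.interval α →
        |birkhoffSum T.map φ (q α) (T.map^[t] y)| ≤ B) →
      ∃ m : ℕ, |birkhoffSum T.map φ n y| ≤ m * B ∧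
        ∀ i < m, ∃ t < n, S.map^[i] y = T.map^[t] y ∧ (0 < i → 0 < t) := by
  induction n using Nat.strong_induction_on with
  | _ n ih =>
    intro y hy hn hB
    rcases Nat.eq_zero_or_pos n with rfl | hpos
    · exact ⟨0, by simp, fun i hi => by omega⟩
    obtain ⟨α, hα⟩ := S.exists_mem_rowInterval 0 hy
    have hq : q α ≤ n := by
      by_contra hlt
      exact h.first α y hα n hpos (not_le.1 hlt) hn
    have hqpos := h.pos α
    have hret := h.ret α y hα
    have hadd : ∀ t, T.map^[t] (S.map y) = T.map^[t + q α] y := by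
      intro t
      rw [hret, ← Function.iterate_add_apply]
    obtain ⟨m, hm, hm'⟩ := ih (n - q α) (by omega) (S.map y) (mapsTo_base hS hy)
      (by rw [hadd, Nat.sub_add_cancel hq]; exact hn)
      (fun t ht β hβ => by
        rw [hadd] at hβ ⊢
        exact hB _ (by omega) β hβ)
    refine ⟨m + 1, ?_, ?_⟩
    · have e : birkhoffSum T.map φ n y =
          birkhoffSum T.map φ (q α) y + birkhoffSum T.map φ (n - q α) (S.map y) := by
        rw [hret, ← birkhoffSum_add, Nat.add_sub_cancel' hq]
      rw [e]
      have h0 := hB 0 hpos α hα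
      rw [Function.iterate_zero, id] at h0
      have := abs_add_le (birkhoffSum T.map φ (q α) y) (birkhoffSum T.map φ (n - q α) (S.map y))
      push_cast
      linarith
    · intro i hi
      rcases i with _ | i
      · exact ⟨0, hpos, rfl, fun h => h⟩
      · obtain ⟨t, ht, ht', -⟩ := hm' i (by omega)
        refine ⟨t + q α, by omega, ?_, fun _ => by omega⟩
        rw [Function.iterate_succ_apply, ht', hadd]

/-- A segment of a `T`-orbit starting and ending in the base of `S` which does not meet the base of
`S'` in between consists of at most `z` passages through the towers over `S`. -/
lemma IsTower.abs_birkhoffSum_le_of_notMem {T S S' : IET A d} {q Z : A → ℕ}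
    (h : IsTower T S q) (h' : IsTower S S' Z) (hS : S.Pos) (hS' : S'.Pos) {z : ℝ}
    (hZ : ∀ α, (Z α : ℝ) ≤ z) {φ : ℝ → ℝ} {B : ℝ} (hB0 : 0 ≤ B) {n : ℕ} {y : ℝ}
    (hy : y ∈ S.base) (hn : T.map^[n] y ∈ S.base)
    (hno : ∀ t, 0 < t → t < n → T.map^[t] y ∉ S'.base)
    (hB : ∀ t < n, ∀ α, T.map^[t] y ∈ S.interval α →
      |birkhoffSum T.map φ (q α) (T.map^[t] y)| ≤ B) :
    |birkhoffSum T.map φ n y| ≤ z * B := by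
  obtain ⟨m, hm, hm'⟩ := h.exists_visits hS n y hy hn hB
  obtain ⟨α, y₀, hy₀, i, hi, hiy⟩ := h'.cover y hy
  -- With more than `Z α` passages the segment would leave the `S'`-tower containing `y`, hence land
  -- in the base of `S'` at an intermediate time.
  have hmZ : m ≤ Z α := by
    by_contra hlt
    obtain ⟨t, ht, ht', ht0⟩ := hm' (Z α - i) (by omega)
    refine hno t (ht0 (by omega)) ht ?_
    rw [← ht', ← hiy, ← Function.iterate_add_apply, Nat.sub_add_cancel hi.le, ← h'.ret α y₀ hy₀]
    exact mapsTo_base hS' (rowInterval_subset_base hS' 0 α hy₀)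
  refine hm.trans (mul_le_mul_of_nonneg_right (le_trans ?_ (hZ α)) hB0)
  exact_mod_cast hmZ

/-- Decomposition of a Birkhoff sum into special Birkhoff sums along a sequence of induced maps. -/
lemma abs_birkhoffSum_le_of_isTower {T : IET A d} {U : ℕ → IET A d} {q Z : ℕ → A → ℕ}
    (hU : ∀ j, (U j).Pos) (h : ∀ j, IsTower T (U j) (q j))
    (h' : ∀ j, IsTower (U j) (U (j + 1)) (Z j)) {k : ℕ} {z : ℝ} (hZ : ∀ j < k, ∀ α, (Z j α : ℝ) ≤ z)
    {φ : ℝ → ℝ} {B : ℝ} (hB0 : 0 ≤ B) (e : ℕ) : ∀ j, j + e = k → ∀ n, (∀ α, n < q k α) →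
      ∀ y ∈ (U j).base, T.map^[n] y ∈ (U j).base →
      (∀ i < k, ∀ t < n, ∀ α, T.map^[t] y ∈ (U i).interval α →
        |birkhoffSum T.map φ (q i α) (T.map^[t] y)| ≤ B) →
      |birkhoffSum T.map φ n y| ≤ e * (2 * (z * B)) := by
  induction e with
  | zero =>
    rintro j rfl n hn y hy hyn -
    obtain ⟨α, hα⟩ := (U j).exists_mem_rowInterval 0 hy
    -- A segment shorter than every return time to level `k` cannot come back to its base.
    have : n = 0 := by
      by_contra h0
      exact (h j).first α y hα n (Nat.pos_of_ne_zero h0) (hn α) hyn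
    subst this
    simp
  | succ e ih =>
    classical
    intro j hj n hn y hy hyn hB
    have hshort := fun n y => (h j).abs_birkhoffSum_le_of_notMem (h' j) (hU j) (hU (j + 1))
      (hZ j (by omega)) (φ := φ) hB0 (n := n) (y := y)
    have hz0 : 0 ≤ z := by
      obtain ⟨α, -⟩ := (U j).exists_mem_rowInterval 0 hy
      exact (Nat.cast_nonneg _).trans (hZ j (by omega) α)
    by_cases hvis : ∃ t ≤ n, T.map^[t] y ∈ (U (j + 1)).base
    · have hne : ((Finset.range (n + 1)).filter
          fun t => T.map^[t] y ∈ (U (j + 1)).base).Nonempty := by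
        obtain ⟨t, ht, ht'⟩ := hvis
        exact ⟨t, Finset.mem_filter.2 ⟨Finset.mem_range.2 (by omega), ht'⟩⟩
      -- Cut at the first and last visits to the next base. The outer pieces avoid that base in
      -- between and cost `z * B` each; the middle piece is handled at level `j + 1`.
      obtain ⟨t₁, ht₁, hmin⟩ := Finset.exists_min_image _ id hne
      obtain ⟨t₂, ht₂, hmax⟩ := Finset.exists_max_image _ id hne
      simp only [Finset.mem_filter, Finset.mem_range, id, and_imp] at ht₁ ht₂ hmin hmax
      have h12 := hmin t₂ ht₂.1 ht₂.2
      have hsub := (h' j).base_subset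
      have e1 : birkhoffSum T.map φ n y = birkhoffSum T.map φ t₁ y +
          birkhoffSum T.map φ (t₂ - t₁) (T.map^[t₁] y) +
          birkhoffSum T.map φ (n - t₂) (T.map^[t₂] y) := by
        obtain ⟨a, rfl⟩ := Nat.exists_eq_add_of_le h12
        obtain ⟨c, rfl⟩ := Nat.exists_eq_add_of_le (Nat.lt_succ_iff.1 ht₂.1)
        rw [birkhoffSum_add, birkhoffSum_add, Nat.add_sub_cancel_left, Nat.add_sub_cancel_left]
      have b1 : |birkhoffSum T.map φ t₁ y| ≤ z * B := by
        refine hshort t₁ y hy (hsub ht₁.2) (fun t _ ht hmem => ?_)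
          (fun t ht => hB j (by omega) t (by omega))
        exact absurd (hmin t (by omega) hmem) (by omega)
      have b2 : |birkhoffSum T.map φ (t₂ - t₁) (T.map^[t₁] y)| ≤ e * (2 * (z * B)) := by
        refine ih (j + 1) (by omega) (t₂ - t₁) (fun α => (Nat.lt_of_le_of_lt ?_ (hn α))) _ ht₁.2 ?_
          (fun i hi t ht α => ?_)
        · omega
        · rw [← Function.iterate_add_apply, Nat.sub_add_cancel h12]
          exact ht₂.2
        · rw [← Function.iterate_add_apply]
          exact hB i hi _ (by omega) α
      have b3 : |birkhoffSum T.map φ (n - t₂) (T.map^[t₂] y)| ≤ z * B := by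
        refine hshort _ _ (hsub ht₂.2) ?_ (fun t h0 ht hmem => ?_) (fun t ht α => ?_)
        · rw [← Function.iterate_add_apply, Nat.sub_add_cancel (Nat.lt_succ_iff.1 ht₂.1)]
          exact hyn
        · rw [← Function.iterate_add_apply] at hmem
          exact absurd (hmax _ (by omega) hmem) (by omega)
        · rw [← Function.iterate_add_apply]
          exact hB j (by omega) _ (by omega) α
      rw [e1]
      have := abs_add_three (birkhoffSum T.map φ t₁ y)
        (birkhoffSum T.map φ (t₂ - t₁) (T.map^[t₁] y))
        (birkhoffSum T.map φ (n - t₂) (T.map^[t₂] y))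
      push_cast
      linarith
    · push Not at hvis
      have := hshort n y hy hyn (fun t _ ht => hvis t ht.le) (fun t ht => hB j (by omega) t ht)
      have hzB := mul_nonneg hz0 hB0
      have he : (0 : ℝ) ≤ e * (2 * (z * B)) := by positivity
      push_cast
      linarith

/-! ### Distortion of special Birkhoff sums -/

/-- Floors of one tower are translates of its base interval. If two were closer than its length they
would overlap, and injectivity of `T` would give a return to `S.base` before the return time. -/
lemma IsTower.len_le_abs_sub {T S : IET A d} {q : A → ℕ} (h : IsTower T S q) (hT : T.Pos)
    (hS : S.Pos) {α : A} {i j : ℕ} (hi : i < q α) (hj : j < q α) (hij : i ≠ j) {y : ℝ}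
    (hy : y ∈ S.interval α) : S.len α ≤ |T.map^[i] y - T.map^[j] y| := by
  wlog hlt : T.map^[i] y ≤ T.map^[j] y generalizing i j
  · rw [abs_sub_comm]
    exact this hj hi hij.symm (le_of_not_ge hlt)
  obtain ⟨_, ci, hci⟩ := h.floor α i hi
  obtain ⟨_, cj, hcj⟩ := h.floor α j hj
  by_contra hcon
  rw [not_le, abs_sub_comm, abs_of_nonneg (sub_nonneg.2 hlt), (hci y hy).1, (hcj y hy).1] at hcon
  rw [(hci y hy).1, (hcj y hy).1] at hlt
  have hx : S.l α + (cj - ci) ∈ S.interval α :=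
    ⟨by linarith, by simp only [r, l] at *; linarith⟩
  have hl := left_mem_interval hS α
  have heq : T.map^[i] (S.l α + (cj - ci)) = T.map^[j] (S.l α) := by
    rw [(hci _ hx).1, (hcj _ hl).1]
    ring
  have hbase : ∀ x ∈ S.interval α, x ∈ S.base := fun x hx => rowInterval_subset_base hS 0 α hx
  have hinj : ∀ m : ℕ, ∀ x ∈ T.base, ∀ y ∈ T.base, T.map^[m] x = T.map^[m] y → x = y := by
    intro m x hx y hy hxy
    exact (injOn_base hT).iterate (mapsTo_base hT) m hx hy hxy
  rcases lt_or_gt_of_ne hij with hlt' | hlt'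
  · have : T.map^[i] (S.l α + (cj - ci)) = T.map^[i] (T.map^[j - i] (S.l α)) := by
      rw [heq, ← Function.iterate_add_apply, Nat.add_sub_cancel' hlt'.le]
    have := hinj i _ (h.base_subset (hbase _ hx)) _
      (iterate_mem_base hT _ (h.base_subset (hbase _ hl))) this
    refine h.first α _ hl (j - i) (by omega) (by omega) ?_
    rw [← this]
    exact hbase _ hx
  · have : T.map^[j] (T.map^[i - j] (S.l α + (cj - ci))) = T.map^[j] (S.l α) := by
      rw [← heq, ← Function.iterate_add_apply, Nat.add_sub_cancel' hlt'.le]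
    have := hinj j _ (iterate_mem_base hT _ (h.base_subset (hbase _ hx))) _
      (h.base_subset (hbase _ hl)) this
    refine h.first α _ hx (i - j) (by omega) (by omega) ?_
    rw [this]
    exact hbase _ hl

/-- The sum `∑ (m + 1) ^ (-p)`. -/
def zetaSum (p : ℝ) : ℝ := ∑' m : ℕ, ((m : ℝ) + 1) ^ (-p)

lemma summable_zetaSum {p : ℝ} (hp : 1 < p) : Summable fun m : ℕ => ((m : ℝ) + 1) ^ (-p) := by
  have := (summable_nat_add_iff 1).2 (Real.summable_nat_rpow.2 (neg_lt_neg hp))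
  simpa using this

lemma zetaSum_nonneg (p : ℝ) : 0 ≤ zetaSum p :=
  tsum_nonneg fun m => by positivity

/-- Sum of a negative power over a separated set of positive numbers. -/
lemma sum_rpow_neg_le_of_separated {ι : Type*} (s : Finset ι) (z : ι → ℝ) {u L p : ℝ} (hu : 0 < u)
    (huL : u ≤ L) (hp : 1 < p) (hz : ∀ i ∈ s, u ≤ z i)
    (hsep : ∀ i ∈ s, ∀ j ∈ s, i ≠ j → L ≤ |z i - z j|) :
    ∑ i ∈ s, z i ^ (-p) ≤ u ^ (-p) * zetaSum p := by
  classical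
  have hL : 0 < L := hu.trans_le huL
  -- Cells of length `L` starting at `u` hold at most one point each, and a point of cell `m`
  -- satisfies `z ≥ u + m * L ≥ u * (m + 1)`.
  set f : ι → ℕ := fun i => ⌊(z i - u) / L⌋₊ with hf
  have hnn : ∀ i ∈ s, 0 ≤ (z i - u) / L := fun i hi => div_nonneg (sub_nonneg.2 (hz i hi)) hL.le
  have hinj : Set.InjOn f s := by
    intro i hi j hj hij
    by_contra hne
    have h1 := Nat.floor_le (hnn i hi)
    have h2 := Nat.lt_floor_add_one ((z i - u) / L)
    have h3 := Nat.floor_le (hnn j hj)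
    have h4 := Nat.lt_floor_add_one ((z j - u) / L)
    simp only [hf] at hij
    rw [hij] at h1 h2
    have h5 := hsep i hi j hj hne
    have h6 : |(z i - u) / L - (z j - u) / L| < 1 := by
      rw [abs_lt]
      constructor <;> linarith
    rw [← sub_div, abs_div, abs_of_pos hL, div_lt_one hL] at h6
    rw [show z i - u - (z j - u) = z i - z j by ring] at h6
    linarith
  have hterm : ∀ i ∈ s, z i ^ (-p) ≤ u ^ (-p) * ((f i : ℝ) + 1) ^ (-p) := by
    intro i hi
    rw [← Real.mul_rpow hu.le (by positivity)]
    refine Real.rpow_le_rpow_of_nonpos (by positivity) ?_ (by linarith)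
    have h1 := Nat.floor_le (hnn i hi)
    rw [le_div_iff₀ hL] at h1
    have : u * (f i : ℝ) ≤ f i * L := by
      rw [mul_comm]
      exact mul_le_mul_of_nonneg_left huL (Nat.cast_nonneg _)
    simp only [hf] at *
    linarith
  calc ∑ i ∈ s, z i ^ (-p) ≤ ∑ i ∈ s, u ^ (-p) * ((f i : ℝ) + 1) ^ (-p) := Finset.sum_le_sum hterm
    _ = u ^ (-p) * ∑ m ∈ s.image f, ((m : ℝ) + 1) ^ (-p) := by
        rw [Finset.sum_image hinj, Finset.mul_sum]
    _ ≤ u ^ (-p) * zetaSum p := by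
        refine mul_le_mul_of_nonneg_left ?_ (by positivity)
        exact (summable_zetaSum hp).sum_le_tsum _ fun m _ => by positivity

/-- `φ` is differentiable inside the exchanged intervals, with polynomial bounds of degree `1 + b`
on its derivative. -/
def HasDerivBound (T : IET A d) (b K : ℝ) (φ : ℝ → ℝ) : Prop :=
  ∀ γ, ∀ x ∈ Set.Ioo (T.l γ) (T.r γ), HasDerivAt φ (deriv φ x) x ∧
    |deriv φ x| ≤ K * ((x - T.l γ) ^ (-(1 + b)) + (T.r γ - x) ^ (-(1 + b)))

lemma abs_le_of_mul_rpow_le {u v K p : ℝ} (hu : 0 < u) (h : |v * u ^ p| ≤ K) :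
    |v| ≤ K * u ^ (-p) := by
  have hp : 0 < u ^ p := Real.rpow_pos_of_pos hu p
  rw [abs_mul, abs_of_pos hp] at h
  rw [Real.rpow_neg hu.le, ← div_eq_mul_inv, le_div_iff₀ hp]
  exact h

/-- Adding the two weights removes the case split at the midpoint. Used for $\varphi_f'$ with `p = 1
+ b` and for $\varphi_{|f|}$ with `p = b`. -/
lemma exists_two_sided_bound {T : IET A d} {p : ℝ} {ψ : ℝ → ℝ} {K : ℝ}
    (h : ∀ α, (∀ x ∈ Set.Ioc (T.l α) (T.mid α), |ψ x * (x - T.l α) ^ p| ≤ K) ∧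
      (∀ x ∈ Set.Ico (T.mid α) (T.r α), |ψ x * (T.r α - x) ^ p| ≤ K)) :
    ∀ γ, ∀ x ∈ Set.Ioo (T.l γ) (T.r γ),
      |ψ x| ≤ |K| * ((x - T.l γ) ^ (-p) + (T.r γ - x) ^ (-p)) := by
  intro γ x hx
  have h1 : 0 < x - T.l γ := sub_pos.2 hx.1
  have h2 : 0 < T.r γ - x := sub_pos.2 hx.2
  have h3 : 0 < (x - T.l γ) ^ (-p) := Real.rpow_pos_of_pos h1 _
  have h4 : 0 < (T.r γ - x) ^ (-p) := Real.rpow_pos_of_pos h2 _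
  have hK := le_abs_self K
  rw [mul_add]
  rcases le_total x (T.mid γ) with hm | hm
  · have := abs_le_of_mul_rpow_le h1 ((h γ).1 x ⟨hx.1, hm⟩)
    have h5 := mul_le_mul_of_nonneg_right hK h3.le
    have h6 := mul_nonneg (abs_nonneg K) h4.le
    linarith
  · have := abs_le_of_mul_rpow_le h2 ((h γ).2 x ⟨hm, hx.2⟩)
    have h5 := mul_le_mul_of_nonneg_right hK h4.le
    have h6 := mul_nonneg (abs_nonneg K) h3.le
    linarith

lemma MemPG.exists_hasDerivBound {T : IET A d} {b : ℝ} {φ : ℝ → ℝ} (h : T.MemPG b φ) :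
    ∃ K, 0 ≤ K ∧ T.HasDerivBound b K φ := by
  obtain ⟨h1, ⟨K, hK⟩, -⟩ := h
  refine ⟨|K|, abs_nonneg K, fun γ x hx => ⟨?_, exists_two_sided_bound hK γ x hx⟩⟩
  exact (((h1 γ).differentiableOn one_ne_zero).differentiableAt
    (isOpen_Ioo.mem_nhds hx)).hasDerivAt

/-- Each floor lies in a single exchanged interval, so a floor point is at least as far from the
ends of that interval as `y` is from the ends of the tower base. Within one exchanged interval the
floor points are separated by the base length, so their contributions sum to at most `zetaSum (1 +
b)` times the weight at `y`; the cardinality counts the exchanged intervals. The bound does not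
involve the height. -/
lemma IsTower.hasDerivAt_birkhoffSum {T S : IET A d} {q : A → ℕ} (h : IsTower T S q) (hT : T.Pos)
    (hS : S.Pos) {b K : ℝ} {φ : ℝ → ℝ} (hb : 0 < b) (hK : 0 ≤ K) (hφ : T.HasDerivBound b K φ)
    {α : A} {y : ℝ} (hy : y ∈ Set.Ioo (S.l α) (S.r α)) :
    ∃ D, HasDerivAt (birkhoffSum T.map φ (q α)) D y ∧
      |D| ≤ Fintype.card A * K * zetaSum (1 + b) *
        ((y - S.l α) ^ (-(1 + b)) + (S.r α - y) ^ (-(1 + b))) := by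
  have : Nonempty A := ⟨α⟩
  choose! γ c hc using h.floor α
  have hyI : y ∈ S.interval α := Set.Ioo_subset_Ico_self hy
  have hlow : ∀ i < q α, y - S.l α ≤ T.map^[i] y - T.l (γ i) := by
    intro i hi
    have h1 := hc i hi _ (left_mem_interval hS α)
    have h2 := (hc i hi y hyI).1
    have h3 := h1.2.1
    rw [h1.1] at h3
    rw [h2]
    linarith
  have hupp : ∀ i < q α, S.r α - y ≤ T.r (γ i) - T.map^[i] y := by
    intro i hi
    by_contra hcon
    rw [not_le, (hc i hi y hyI).1] at hcon
    -- A point of the base whose image on floor `i` would lie at or beyond the right end of the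
    -- exchanged interval.
    have hmem : max y (T.r (γ i) - c i) ∈ S.interval α := by
      refine ⟨hyI.1.trans (le_max_left _ _), max_lt hy.2 ?_⟩
      linarith
    have h1 := hc i hi _ hmem
    have h2 := h1.2.2
    rw [h1.1] at h2
    linarith [le_max_right y (T.r (γ i) - c i)]
  have hu : 0 < y - S.l α := sub_pos.2 hy.1
  have hv : 0 < S.r α - y := sub_pos.2 hy.2
  have hin : ∀ i < q α, T.map^[i] y ∈ Set.Ioo (T.l (γ i)) (T.r (γ i)) := fun i hi =>
    ⟨by linarith [hlow i hi], by linarith [hupp i hi]⟩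
  refine ⟨∑ i ∈ Finset.range (q α), deriv φ (T.map^[i] y), ?_, ?_⟩
  · have hsum : HasDerivAt (fun x => ∑ i ∈ Finset.range (q α), φ (x + c i))
        (∑ i ∈ Finset.range (q α), deriv φ (T.map^[i] y)) y := by
      refine HasDerivAt.fun_sum fun i hi => ?_
      have hi' := Finset.mem_range.1 hi
      have := (hφ (γ i) _ (hin i hi')).1
      rw [(hc i hi' y hyI).1] at this ⊢
      exact this.comp_add_const y (c i)
    refine hsum.congr_of_eventuallyEq ?_
    filter_upwards [isOpen_Ioo.mem_nhds hy] with x hx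
    simp only [birkhoffSum]
    refine Finset.sum_congr rfl fun i hi => ?_
    rw [(hc i (Finset.mem_range.1 hi) x (Set.Ioo_subset_Ico_self hx)).1]
  · have hsplit : ∀ (w : ℕ → ℝ) (u : ℝ), 0 < u → u ≤ S.len α → (∀ i < q α, u ≤ w i) →
        (∀ i < q α, ∀ j < q α, γ i = γ j → |w i - w j| = |T.map^[i] y - T.map^[j] y|) →
        ∑ i ∈ Finset.range (q α), w i ^ (-(1 + b)) ≤
          Fintype.card A * (u ^ (-(1 + b)) * zetaSum (1 + b)) := by
      intro w u hu huL hw hsep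
      -- Floors are grouped by the exchanged interval containing them; separation is used within
      -- each group.
      rw [← Finset.sum_fiberwise (Finset.range (q α)) γ, ← nsmul_eq_mul, ← Finset.card_univ]
      refine Finset.sum_le_card_nsmul _ _ _ fun g _ => ?_
      refine sum_rpow_neg_le_of_separated _ w hu huL (by linarith) (fun i hi => ?_)
        (fun i hi j hj hij => ?_)
      · exact hw i (Finset.mem_range.1 (Finset.mem_filter.1 hi).1)
      · obtain ⟨hi1, hi2⟩ := Finset.mem_filter.1 hi
        obtain ⟨hj1, hj2⟩ := Finset.mem_filter.1 hj
        rw [hsep i (Finset.mem_range.1 hi1) j (Finset.mem_range.1 hj1) (hi2.trans hj2.symm)]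
        exact h.len_le_abs_sub hT hS (Finset.mem_range.1 hi1) (Finset.mem_range.1 hj1) hij hyI
    have s1 := hsplit (fun i => T.map^[i] y - T.l (γ i)) (y - S.l α) hu
      (by have := hy.2; simp only [r, l] at *; linarith) hlow
      (fun i _ j _ hij => by simp only [hij]; congr 1; ring)
    have s2 := hsplit (fun i => T.r (γ i) - T.map^[i] y) (S.r α - y) hv
      (by have := hy.1; simp only [r, l] at *; linarith) hupp
      (fun i _ j _ hij => by simp only [hij]; rw [abs_sub_comm]; congr 1; ring)
    calc |∑ i ∈ Finset.range (q α), deriv φ (T.map^[i] y)|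
        ≤ ∑ i ∈ Finset.range (q α), |deriv φ (T.map^[i] y)| := Finset.abs_sum_le_sum_abs _ _
      _ ≤ ∑ i ∈ Finset.range (q α), K * ((T.map^[i] y - T.l (γ i)) ^ (-(1 + b)) +
            (T.r (γ i) - T.map^[i] y) ^ (-(1 + b))) :=
          Finset.sum_le_sum fun i hi => (hφ (γ i) _ (hin i (Finset.mem_range.1 hi))).2
      _ = K * (∑ i ∈ Finset.range (q α), (T.map^[i] y - T.l (γ i)) ^ (-(1 + b)) +
            ∑ i ∈ Finset.range (q α), (T.r (γ i) - T.map^[i] y) ^ (-(1 + b))) := by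
          rw [← Finset.mul_sum, Finset.sum_add_distrib]
      _ ≤ K * (Fintype.card A * ((y - S.l α) ^ (-(1 + b)) * zetaSum (1 + b)) +
            Fintype.card A * ((S.r α - y) ^ (-(1 + b)) * zetaSum (1 + b))) :=
          mul_le_mul_of_nonneg_left (add_le_add s1 s2) hK
      _ = _ := by ring

/-! ### Functions on an interval with polynomially bounded derivative -/

/-- The weight `(x - l) ^ (-b) + (r - x) ^ (-b)`. -/
def endWeight (b l r x : ℝ) : ℝ := (x - l) ^ (-b) + (r - x) ^ (-b)

lemma endWeight_le {b l r x η : ℝ} (hb : 0 < b) (hη : 0 < η) (h1 : η ≤ x - l) (h2 : η ≤ r - x) :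
    endWeight b l r x ≤ 2 * η ^ (-b) := by
  have h3 := Real.rpow_le_rpow_of_nonpos hη h1 (neg_nonpos.2 hb.le)
  have h4 := Real.rpow_le_rpow_of_nonpos hη h2 (neg_nonpos.2 hb.le)
  rw [endWeight]
  linarith

/-- With `G` an antiderivative of the bound on `F'`, both `G + F` and `G - F` are monotone, so
$|F(x)-F(y)|\le G(y)-G(x)$ for $x\le y$; the terms of the wrong sign are then replaced by their
absolute values. -/
lemma abs_sub_le_endWeight {F : ℝ → ℝ} {l r b D : ℝ} (hb : 0 < b) (hD : 0 ≤ D)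
    (hF : ∀ x ∈ Set.Ioo l r, ∃ F', HasDerivAt F F' x ∧
      |F'| ≤ D * ((x - l) ^ (-(1 + b)) + (r - x) ^ (-(1 + b))))
    {x y : ℝ} (hx : x ∈ Set.Ioo l r) (hy : y ∈ Set.Ioo l r) :
    |F x - F y| ≤ D / b * (endWeight b l r x + endWeight b l r y) := by
  wlog hxy : x ≤ y generalizing x y
  · rw [abs_sub_comm, add_comm]
    exact this hy hx (le_of_not_ge hxy)
  set G : ℝ → ℝ := fun t => D / b * (-(t - l) ^ (-b) + (r - t) ^ (-b)) with hG
  have hGd : ∀ t ∈ Set.Ioo l r,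
      HasDerivAt G (D * ((t - l) ^ (-(1 + b)) + (r - t) ^ (-(1 + b)))) t := by
    intro t ht
    have h1 : HasDerivAt (fun t : ℝ => (t - l) ^ (-b)) (1 * (-b) * (t - l) ^ (-b - 1)) t :=
      ((hasDerivAt_id t).sub_const l).rpow_const (Or.inl (sub_pos.2 ht.1).ne')
    have h2 : HasDerivAt (fun t : ℝ => (r - t) ^ (-b)) (-1 * (-b) * (r - t) ^ (-b - 1)) t :=
      ((hasDerivAt_id t).const_sub r).rpow_const (Or.inl (sub_pos.2 ht.2).ne')
    refine ((h1.neg.add h2).const_mul (D / b)).congr_deriv ?_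
    rw [show -b - 1 = -(1 + b) by ring]
    field_simp
  have hdata : ∀ t ∈ Set.Ioo l r, DifferentiableAt ℝ F t ∧
      |deriv F t| ≤ D * ((t - l) ^ (-(1 + b)) + (r - t) ^ (-(1 + b))) := by
    intro t ht
    obtain ⟨F', h1, h2⟩ := hF t ht
    exact ⟨h1.differentiableAt, by rwa [h1.deriv]⟩
  have hmono : ∀ σ : ℝ, |σ| = 1 → MonotoneOn (fun t => G t + σ * F t) (Set.Ioo l r) := by
    intro σ hσ
    have hd : ∀ t ∈ Set.Ioo l r, HasDerivAt (fun t => G t + σ * F t)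
        (D * ((t - l) ^ (-(1 + b)) + (r - t) ^ (-(1 + b))) + σ * deriv F t) t := fun t ht =>
      (hGd t ht).add ((hdata t ht).1.hasDerivAt.const_mul σ)
    refine monotoneOn_of_deriv_nonneg (convex_Ioo l r)
      (fun t ht => (hd t ht).continuousAt.continuousWithinAt) ?_ ?_
    · rw [interior_Ioo]
      exact fun t ht => (hd t ht).differentiableAt.differentiableWithinAt
    · rw [interior_Ioo]
      intro t ht
      rw [(hd t ht).deriv]
      have h1 := neg_abs_le (σ * deriv F t)
      rw [abs_mul, hσ, one_mul] at h1
      linarith [(hdata t ht).2]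
  have h1 := hmono 1 (by simp) hx hy hxy
  have h2 := hmono (-1) (by simp) hx hy hxy
  simp only [hG] at h1 h2
  have hDb : 0 ≤ D / b := by positivity
  have e1 : 0 ≤ D / b * (r - x) ^ (-b) :=
    mul_nonneg hDb (Real.rpow_nonneg (sub_nonneg.2 hx.2.le) _)
  have e2 : 0 ≤ D / b * (y - l) ^ (-b) :=
    mul_nonneg hDb (Real.rpow_nonneg (sub_nonneg.2 hy.1.le) _)
  rw [endWeight, endWeight, abs_le]
  constructor <;> nlinarith

lemma intervalIntegrable_endWeight {b l r : ℝ} (hb1 : b < 1) :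
    IntervalIntegrable (endWeight b l r) volume l r := by
  have h1 : IntervalIntegrable (fun x : ℝ => (x - l) ^ (-b)) volume l r := by
    have := (intervalIntegral.intervalIntegrable_rpow' (a := 0) (b := r - l)
      (show -1 < -b by linarith)).comp_sub_right l
    simpa using this
  have h2 : IntervalIntegrable (fun x : ℝ => (r - x) ^ (-b)) volume l r := by
    have := (intervalIntegral.intervalIntegrable_rpow' (a := r - l) (b := 0)
      (show -1 < -b by linarith)).comp_sub_left r
    simpa using this
  exact h1.add h2

lemma integral_endWeight {b l r : ℝ} (hb1 : b < 1) :
    ∫ x in l..r, endWeight b l r x = 2 * (r - l) ^ (1 - b) / (1 - b) := by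
  have hb' : -1 < -b := by linarith
  have h1 : IntervalIntegrable (fun x : ℝ => (x - l) ^ (-b)) volume l r := by
    have := (intervalIntegral.intervalIntegrable_rpow' (a := 0) (b := r - l) hb').comp_sub_right l
    simpa using this
  have h2 : IntervalIntegrable (fun x : ℝ => (r - x) ^ (-b)) volume l r := by
    have := (intervalIntegral.intervalIntegrable_rpow' (a := r - l) (b := 0) hb').comp_sub_left r
    simpa using this
  have e1 : ∫ x in l..r, (x - l) ^ (-b) = (r - l) ^ (1 - b) / (1 - b) := by
    rw [intervalIntegral.integral_comp_sub_right (fun x : ℝ => x ^ (-b)) l,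
      integral_rpow (Or.inl hb'), sub_self, show -b + 1 = 1 - b by ring,
      Real.zero_rpow (by linarith), sub_zero]
  have e2 : ∫ x in l..r, (r - x) ^ (-b) = (r - l) ^ (1 - b) / (1 - b) := by
    rw [intervalIntegral.integral_comp_sub_left (fun x : ℝ => x ^ (-b)) r,
      integral_rpow (Or.inl hb'), sub_self, show -b + 1 = 1 - b by ring,
      Real.zero_rpow (by linarith), sub_zero]
  simp only [endWeight]
  rw [intervalIntegral.integral_add h1 h2, e1, e2]
  ring

/-- Average `abs_sub_le_endWeight` over `y`. The weight is integrable because `b < 1`, and its mean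
is $\frac{2}{1-b}(r-l)^{-b}$. -/
lemma abs_le_abs_average_add {F : ℝ → ℝ} {l r b D : ℝ} (hlr : l < r) (hb : 0 < b) (hb1 : b < 1)
    (hD : 0 ≤ D) (hF : ∀ x ∈ Set.Ioo l r, ∃ F', HasDerivAt F F' x ∧
      |F'| ≤ D * ((x - l) ^ (-(1 + b)) + (r - x) ^ (-(1 + b))))
    {x : ℝ} (hx : x ∈ Set.Ioo l r) :
    |F x| ≤ |⨍ y in Set.Ico l r, F y| +
      D / b * (endWeight b l r x + 2 / (1 - b) * (r - l) ^ (-b)) := by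
  have hlr0 : 0 < r - l := sub_pos.2 hlr
  have hae : ∀ᵐ y : ℝ, y ∈ Set.Ioc l r → y ∈ Set.Ioo l r := by
    have : ∀ᵐ y : ℝ, y ≠ r := by simp [ae_iff]
    filter_upwards [this] with y hy hy'
    exact ⟨hy'.1, lt_of_le_of_ne hy'.2 hy⟩
  set V : ℝ → ℝ := fun y => D / b * (endWeight b l r x + endWeight b l r y) with hV
  have hVint : IntervalIntegrable V volume l r :=
    (intervalIntegrable_const.add (intervalIntegrable_endWeight hb1)).const_mul _
  have hFint : IntervalIntegrable (fun y => F x - F y) volume l r := by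
    refine hVint.mono_fun' ?_ ?_
    · rw [Set.uIoc_of_le hlr.le, ← restrict_Ioo_eq_restrict_Ioc]
      refine ContinuousOn.aestronglyMeasurable ?_ measurableSet_Ioo
      refine continuousOn_const.sub fun y hy => ?_
      obtain ⟨F', h1, -⟩ := hF y hy
      exact h1.continuousAt.continuousWithinAt
    · rw [Set.uIoc_of_le hlr.le]
      filter_upwards [ae_restrict_of_ae hae, ae_restrict_mem measurableSet_Ioc] with y hy hy'
      exact abs_sub_le_endWeight hb hD hF hx (hy hy')
  have hle : ‖∫ y in l..r, (F x - F y)‖ ≤ ∫ y in l..r, V y := by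
    refine intervalIntegral.norm_integral_le_of_norm_le hlr.le ?_ hVint
    filter_upwards [hae] with y hy hy'
    exact abs_sub_le_endWeight hb hD hF hx (hy hy')
  have hFi : IntervalIntegrable F volume l r := by
    have := (intervalIntegrable_const (μ := volume) (a := l) (b := r) (c := F x)).sub hFint
    simpa using this
  have e1 : ∫ y in l..r, (F x - F y) = (r - l) * (F x - ⨍ y in Set.Ico l r, F y) := by
    rw [intervalIntegral.integral_sub intervalIntegrable_const hFi,
      intervalIntegral.integral_const, setAverage_eq, intervalIntegral.integral_of_le hlr.le,
      ← integral_Ico_eq_integral_Ioc, Real.volume_real_Ico_of_le hlr.le]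
    simp only [smul_eq_mul]
    field_simp
  have e2 : ∫ y in l..r, V y = (r - l) *
      (D / b * (endWeight b l r x + 2 / (1 - b) * (r - l) ^ (-b))) := by
    simp only [hV]
    rw [intervalIntegral.integral_const_mul, intervalIntegral.integral_add intervalIntegrable_const
      (intervalIntegrable_endWeight hb1), intervalIntegral.integral_const, integral_endWeight hb1,
      show 1 - b = 1 + -b by ring, Real.rpow_add hlr0, Real.rpow_one, smul_eq_mul]
    ring
  rw [e1, e2, Real.norm_eq_abs, abs_mul, abs_of_pos hlr0] at hle
  have h1 := le_of_mul_le_mul_left hle hlr0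
  have h2 := abs_sub_abs_le_abs_sub (F x) (⨍ y in Set.Ico l r, F y)
  linarith

/-! ### Invariance of Lebesgue measure and a Borel–Cantelli argument -/

lemma measurable_map (T : IET A d) : Measurable T.map := by
  unfold map
  exact measurable_id.add (Finset.measurable_fun_sum _ fun α _ =>
    measurable_const.indicator measurableSet_Ico)

lemma volume_inter_base {T : IET A d} (hT : T.Pos) (ε : Fin 2) {s : Set ℝ} (hs : MeasurableSet s) :
    volume (s ∩ T.base) = ∑ α, volume (s ∩ T.rowInterval ε α) := by
  have : s ∩ T.base = ⋃ α ∈ Finset.univ, s ∩ T.rowInterval ε α := by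
    ext x
    simp only [Set.mem_inter_iff, Finset.mem_univ, Set.iUnion_true, Set.mem_iUnion]
    constructor
    · rintro ⟨h1, h2⟩
      obtain ⟨α, hα⟩ := T.exists_mem_rowInterval ε h2
      exact ⟨α, h1, hα⟩
    · rintro ⟨α, h1, h2⟩
      exact ⟨h1, rowInterval_subset_base hT ε α h2⟩
  rw [this, measure_biUnion_finset]
  · intro α _ β _ h
    exact (rowInterval_disjoint hT ε h).mono Set.inter_subset_right Set.inter_subset_right
  · exact fun α _ => hs.inter measurableSet_Ico

/-- The preimage of the piece of a set in an interval after the exchange is a translate of that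
piece. -/
lemma measurePreserving_map {T : IET A d} (hT : T.Pos) :
    MeasurePreserving T.map (volume.restrict T.base) (volume.restrict T.base) := by
  refine ⟨T.measurable_map, ?_⟩
  ext s hs
  have hs' : MeasurableSet (T.map ⁻¹' s) := T.measurable_map hs
  rw [Measure.map_apply T.measurable_map hs, Measure.restrict_apply hs', Measure.restrict_apply hs,
    volume_inter_base hT 0 hs', volume_inter_base hT 1 hs]
  refine Finset.sum_congr rfl fun α _ => ?_
  have : T.map ⁻¹' s ∩ T.rowInterval 0 α =
      (fun x => x + (T.left 1 α - T.left 0 α)) ⁻¹' (s ∩ T.rowInterval 1 α) := by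
    ext x
    simp only [Set.mem_inter_iff, Set.mem_preimage]
    have hiff : x + (T.left 1 α - T.left 0 α) ∈ T.rowInterval 1 α ↔ x ∈ T.rowInterval 0 α := by
      simp only [rowInterval, Set.mem_Ico]
      constructor <;> rintro ⟨h1, h2⟩ <;> constructor <;> linarith
    rw [hiff]
    refine and_congr_left fun hx => ?_
    rw [map_of_mem hT hx]
  rw [this, measure_preimage_add_right]

/-- The points at distance less than `η` from the ends of the exchanged intervals. -/
def nearEnds (S : IET A d) (η : ℝ) : Set ℝ :=
  ⋃ α, Set.Ico (S.l α) (S.l α + η) ∪ Set.Ioc (S.r α - η) (S.r α)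

lemma measurableSet_nearEnds (S : IET A d) (η : ℝ) : MeasurableSet (S.nearEnds η) :=
  MeasurableSet.iUnion fun _ => measurableSet_Ico.union measurableSet_Ioc

lemma volume_nearEnds_le (S : IET A d) (η : ℝ) :
    volume (S.nearEnds η) ≤ ENNReal.ofReal (Fintype.card A * (2 * η)) := by
  calc volume (S.nearEnds η)
      ≤ ∑ α, volume (Set.Ico (S.l α) (S.l α + η) ∪ Set.Ioc (S.r α - η) (S.r α)) :=
        measure_iUnion_fintype_le _ _
    _ ≤ ∑ α : A, (ENNReal.ofReal η + ENNReal.ofReal η) := by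
        refine Finset.sum_le_sum fun α _ => (measure_union_le _ _).trans ?_
        rw [Real.volume_Ico, Real.volume_Ioc]
        simp
    _ = ENNReal.ofReal (Fintype.card A * (2 * η)) := by
        rw [Finset.sum_const, ENNReal.ofReal_mul (by positivity),
          ENNReal.ofReal_mul (by norm_num), ENNReal.ofReal_natCast, Finset.card_univ, nsmul_eq_mul,
          ← two_mul]
        simp

lemma gaps_of_notMem_nearEnds {S : IET A d} {η x : ℝ} (hη : 0 < η) {α : A}
    (hx : x ∈ S.interval α) (h : x ∉ S.nearEnds η) :
    x ∈ Set.Ioo (S.l α) (S.r α) ∧ η ≤ x - S.l α ∧ η ≤ S.r α - x := by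
  simp only [nearEnds, Set.mem_iUnion, not_exists, Set.mem_union, not_or, Set.mem_Ico,
    Set.mem_Ioc, not_and, not_lt, not_le] at h
  obtain ⟨h1, h2⟩ := h α
  have h3 := h1 hx.1
  have h4 : x ≤ S.r α - η := by
    by_contra hcon
    exact absurd (h2 (not_le.1 hcon)) (not_lt.2 hx.2.le)
  exact ⟨⟨by linarith, hx.2⟩, by linarith, by linarith⟩

/-- Borel–Cantelli: by invariance of the measure, each of the $N_k(k+1)$ preimages has measure at
most $2|\mathcal A|\eta_k$. -/
lemma ae_eventually_notMem_nearEnds {T : IET A d} (hT : T.Pos) (U : ℕ → IET A d) (N : ℕ → ℕ)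
    (η : ℕ → ℝ) (hη : ∀ k, 0 ≤ η k) (hsum : Summable fun k => N k * ((k + 1 : ℝ) * η k)) :
    ∀ᵐ x ∂(volume.restrict T.base), ∀ᶠ k in atTop, ∀ t < N k, ∀ j ≤ k,
      T.map^[t] x ∉ (U j).nearEnds (η k) := by
  set s : ℕ → Set ℝ := fun k =>
    ⋃ t ∈ Finset.range (N k), ⋃ j ∈ Finset.range (k + 1), T.map^[t] ⁻¹' (U j).nearEnds (η k) with hs
  have hle : ∀ k, volume.restrict T.base (s k) ≤
      ENNReal.ofReal (2 * Fintype.card A * (N k * ((k + 1 : ℝ) * η k))) := by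
    intro k
    calc volume.restrict T.base (s k)
        ≤ ∑ t ∈ Finset.range (N k), ∑ j ∈ Finset.range (k + 1),
            volume.restrict T.base (T.map^[t] ⁻¹' (U j).nearEnds (η k)) :=
          (measure_biUnion_finset_le _ _).trans
            (Finset.sum_le_sum fun t _ => measure_biUnion_finset_le _ _)
      _ ≤ ∑ t ∈ Finset.range (N k), ∑ j ∈ Finset.range (k + 1),
            ENNReal.ofReal (Fintype.card A * (2 * η k)) := by
          refine Finset.sum_le_sum fun t _ => Finset.sum_le_sum fun j _ => ?_
          rw [((measurePreserving_map hT).iterate t).measure_preimage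
            ((U j).measurableSet_nearEnds _).nullMeasurableSet]
          exact (Measure.restrict_apply_le _ _).trans ((U j).volume_nearEnds_le _)
      _ = _ := by
          have hk := hη k
          rw [Finset.sum_const, Finset.sum_const, Finset.card_range, Finset.card_range,
            nsmul_eq_mul, nsmul_eq_mul, ← ENNReal.ofReal_natCast, ← ENNReal.ofReal_natCast,
            ← ENNReal.ofReal_mul (by positivity), ← ENNReal.ofReal_mul (by positivity)]
          congr 1
          push_cast
          ring
  have hfin : ∑' k, volume.restrict T.base (s k) ≠ ⊤ :=
    ne_top_of_le_ne_top (hsum.mul_left (2 * (Fintype.card A : ℝ))).tsum_ofReal_ne_top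
      (ENNReal.tsum_le_tsum hle)
  filter_upwards [ae_eventually_notMem hfin] with x hx
  filter_upwards [hx] with k hk t ht j hj hmem
  refine hk ?_
  simp only [hs, Set.mem_iUnion, Finset.mem_range]
  exact ⟨t, ht, j, by omega, hmem⟩

/-! ### Towers along an acceleration -/

lemma acc_pos {T : IET A d} (hT : T.Pos) (hK : T.Keane) (n : ℕ → ℕ) (k : ℕ) : (T.acc n k).Pos :=
  (hK.rauzy_iterate hT _).1

lemma acc_zero {T : IET A d} {n : ℕ → ℕ} (hn : IsAccel n) : T.acc n 0 = T := by
  rw [acc, hn.2]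
  rfl

lemma height_eq {T : IET A d} {n : ℕ → ℕ} (hn : IsAccel n) (k : ℕ) (α : A) :
    T.height n k α = ∑ β, T.kz (n k) β α := by
  simp only [height, Q, acc_zero hn, hn.2, Matrix.transpose_apply, Nat.sub_zero]

lemma isTower_acc {T : IET A d} (hT : T.Pos) (hK : T.Keane) {n : ℕ → ℕ} (hn : IsAccel n) (k : ℕ) :
    IsTower T (T.acc n k) (T.height n k) := by
  have : T.height n k = fun α => ∑ β, T.kz (n k) β α := funext (height_eq hn k)
  rw [this]
  exact hK.isTower_rauzy_iterate hT (n k)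

lemma isTower_acc_succ {T : IET A d} (hT : T.Pos) (hK : T.Keane) {n : ℕ → ℕ} (hn : IsAccel n)
    (k : ℕ) : IsTower (T.acc n k) (T.acc n (k + 1)) fun α => ∑ β, T.Zsucc n k α β := by
  obtain ⟨h1, h2⟩ := hK.rauzy_iterate hT (n k)
  have := h2.isTower_rauzy_iterate h1 (n (k + 1) - n k)
  rw [← Function.iterate_add_apply, Nat.sub_add_cancel (hn.1.monotone (Nat.le_succ k))] at this
  exact this

lemma row_sum_le_mnorm (B : Matrix A A ℕ) (α : A) : ((∑ β, B α β : ℕ) : ℝ) ≤ mnorm B := by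
  rw [mnorm]
  exact_mod_cast Finset.le_sup (f := fun α => ∑ β, B α β) (Finset.mem_univ α)

lemma exists_row_sum_eq_mnorm [Nonempty A] (B : Matrix A A ℕ) :
    ∃ α, ((∑ β, B α β : ℕ) : ℝ) = mnorm B := by
  obtain ⟨α, -, h⟩ := Finset.exists_mem_eq_sup Finset.univ Finset.univ_nonempty
    fun α => ∑ β, B α β
  exact ⟨α, by rw [mnorm, h]⟩

lemma le_card_mul_mnorm {T : IET A d} (hT : T.Pos) (hK : T.Keane) {n : ℕ → ℕ} (hn : IsAccel n)
    (k : ℕ) : (k : ℝ) ≤ Fintype.card A * mnorm (T.Q n 0 k) := by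
  have h1 : k ≤ ∑ α, T.height n k α := by
    calc k ≤ n k := hn.1.le_apply
      _ ≤ ∑ α, ∑ β, T.kz (n k) β α := hK.le_sum_kz hT _
      _ = _ := Finset.sum_congr rfl fun α _ => (height_eq hn k α).symm
  calc (k : ℝ) ≤ ∑ α, (T.height n k α : ℝ) := by exact_mod_cast h1
    _ ≤ ∑ _α : A, mnorm (T.Q n 0 k) := Finset.sum_le_sum fun α _ => row_sum_le_mnorm _ α
    _ = _ := by rw [Finset.sum_const, Finset.card_univ, nsmul_eq_mul]

lemma total_pos {T : IET A d} (hT : T.Pos) : 0 < T.total :=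
  Finset.sum_pos (fun α _ => hT α) ⟨T.first 0, Finset.mem_univ _⟩

/-- If $\lambda_1\le0$, the upper bound would keep $\|Q(k)\|\le C$, whereas the heights at level `k`
add up to at least `k`. -/
lemma IsFDCAccel.lam_one_pos {T : IET A d} (hT : T.Pos) (hK : T.Keane) {lam : ℕ → ℝ}
    {E : ℤ → Submodule ℝ (A → ℝ)} {τ : ℝ} (hτ : 0 < τ) {n : ℕ → ℕ}
    (h : T.IsFDCAccel lam E τ n) : 0 < lam 1 := by
  obtain ⟨hn, c, C, κ, δ, -, hC, -, -, -, ρ, U, -, -, -, hB⟩ := h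
  by_contra hneg
  rw [not_lt] at hneg
  obtain ⟨k, hk⟩ := exists_nat_gt (Fintype.card A * C)
  have h1 := le_card_mul_mnorm hT hK hn k
  have h2 := hB.upper_Q k
  have h3 : Real.exp (lam 1 * (1 + τ) * k) ≤ 1 := by
    rw [Real.exp_le_one_iff]
    have : 0 ≤ (1 + τ) * k := by positivity
    rw [mul_assoc]
    exact mul_nonpos_of_nonpos_of_nonneg hneg this
  have h4 : mnorm (T.Q n 0 k) ≤ C := h2.trans (by nlinarith)
  have h5 := mul_le_mul_of_nonneg_left h4 (Nat.cast_nonneg (Fintype.card A) : (0 : ℝ) ≤ _)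
  linarith

section bounds

variable {T : IET A d} {lam : ℕ → ℝ} {E : ℤ → Submodule ℝ (A → ℝ)} {τ : ℝ} {n : ℕ → ℕ}
  {c C κ δ : ℝ} {ρ : ℕ → ℕ} {U : ℕ → Submodule ℝ (A → ℝ)}

lemma FDCBounds.total_acc_le (hT : T.Pos) (hK : T.Keane)
    (hB : T.FDCBounds lam E τ n c C κ ρ U) (k : ℕ) (α : A) :
    (T.acc n k).total ≤ κ * (T.acc n k).len α := by
  have := hB.balanced k α
  rwa [div_le_iff₀ (acc_pos hT hK n k α)] at this

/-- The towers fill $I$, so $|I|\le\|Q(k)\|\,|I^{(k)}|\le\|Q(k)\|\,\kappa|I^{(k)}_\alpha|$. -/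
lemma FDCBounds.le_len (hT : T.Pos) (hK : T.Keane) (hn : IsAccel n)
    (hC : 1 ≤ C) (hκ : 1 ≤ κ) (hB : T.FDCBounds lam E τ n c C κ ρ U) (k : ℕ) (α : A) :
    T.total / (κ * C) * Real.exp (-(lam 1 * (1 + τ) * k)) ≤ (T.acc n k).len α := by
  have hlen := acc_pos hT hK n k
  have h1 : T.total ≤ mnorm (T.Q n 0 k) * (T.acc n k).total := by
    rw [← (isTower_acc hT hK hn k).total_eq, total, Finset.mul_sum]
    exact Finset.sum_le_sum fun β _ =>
      mul_le_mul_of_nonneg_right (row_sum_le_mnorm _ β) (hlen β).le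
  have h2 := hB.total_acc_le hT hK k α
  have h3 := hB.upper_Q k
  have h4 : T.total ≤ C * Real.exp (lam 1 * (1 + τ) * k) * (κ * (T.acc n k).len α) :=
    h1.trans (mul_le_mul h3 h2 (total_pos hlen).le (by positivity))
  rw [Real.exp_neg, ← div_eq_mul_inv, div_div, div_le_iff₀ (by positivity)]
  linarith

/-- If $\beta$ is the tallest tower, then
$\|Q(k)\|\,|I^{(k)}_\beta|\le|I|\le\delta^{-1}p\,|I^{(k)}|\le\delta^{-1}p\,\kappa|I^{(k)}_\beta|$.
Hence `p`, which is below every height, is at least $\delta\|Q(k)\|/\kappa$. -/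
lemma FDCBounds.le_height (hT : T.Pos) (hK : T.Keane) (hn : IsAccel n) (hκ : 1 ≤ κ)
    (hδ : 0 < δ) (hR : T.RokhlinTowers n δ) (hB : T.FDCBounds lam E τ n c C κ ρ U) {k : ℕ}
    (hk : 1 ≤ k) (α : A) : δ * c / κ * Real.exp (lam 1 * k) ≤ T.height n k α := by
  have : Nonempty A := ⟨α⟩
  have hlen := acc_pos hT hK n k
  obtain ⟨p, -, hp, -, -, hpδ⟩ := hR k hk
  obtain ⟨β, hβ⟩ := exists_row_sum_eq_mnorm (T.Q n 0 k)
  have h1 : mnorm (T.Q n 0 k) * (T.acc n k).len β ≤ T.total := by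
    rw [← (isTower_acc hT hK hn k).total_eq, ← hβ]
    exact Finset.single_le_sum (f := fun β => (T.height n k β : ℝ) * (T.acc n k).len β)
      (fun γ _ => mul_nonneg (Nat.cast_nonneg _) (hlen γ).le) (Finset.mem_univ β)
  have h2 := hB.total_acc_le hT hK k β
  have h3 : δ * (mnorm (T.Q n 0 k) * (T.acc n k).len β) ≤ p * (κ * (T.acc n k).len β) :=
    (mul_le_mul_of_nonneg_left h1 hδ.le).trans
      (hpδ.trans (mul_le_mul_of_nonneg_left h2 (Nat.cast_nonneg p)))
  have h4 : δ * mnorm (T.Q n 0 k) ≤ p * κ := by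
    refine le_of_mul_le_mul_right ?_ (hlen β)
    linarith
  have h5 := mul_le_mul_of_nonneg_left (hB.lower_Q k) hδ.le
  have h6 : (p : ℝ) ≤ T.height n k α := by exact_mod_cast hp α
  refine le_trans ?_ h6
  rw [div_mul_eq_mul_div, div_le_iff₀ (by positivity)]
  linarith

end bounds

/-! ### Growth of Birkhoff sums along generic orbits -/

lemma IsTower.abs_birkhoffSum_le_meanProj {T S : IET A d} {q : A → ℕ} (h : IsTower T S q)
    (hT : T.Pos) (hS : S.Pos) {b K : ℝ} {φ : ℝ → ℝ} (hb : 0 < b) (hb1 : b < 1) (hK : 0 ≤ K)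
    (hφ : T.HasDerivBound b K φ) {α : A} {y : ℝ} (hy : y ∈ Set.Ioo (S.l α) (S.r α)) :
    |birkhoffSum T.map φ (q α) y| ≤
      |⨍ x in S.interval α, birkhoffSum T.map φ (q α) x| +
        Fintype.card A * K * zetaSum (1 + b) / b *
          (endWeight b (S.l α) (S.r α) y + 2 / (1 - b) * S.len α ^ (-b)) := by
  have hlr : S.l α < S.r α := hy.1.trans hy.2
  have := abs_le_abs_average_add hlr hb hb1
    (mul_nonneg (mul_nonneg (Nat.cast_nonneg _) hK) (zetaSum_nonneg _))
    (fun x hx => h.hasDerivAt_birkhoffSum hT hS hb hK hφ hx) hy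
  rwa [show S.r α - S.l α = S.len α by simp [r, l]] at this

lemma average_birkhoffSum_eq_meanProj {T : IET A d} (n : ℕ → ℕ) (k : ℕ)
    (hS : (T.acc n k).Pos) (φ : ℝ → ℝ) (α : A) :
    ⨍ x in (T.acc n k).interval α, birkhoffSum T.map φ (T.height n k α) x =
      (T.acc n k).meanProj (T.specialSum n k φ) α := by
  rw [meanProj]
  refine setAverage_congr_fun measurableSet_Ico (ae_of_all _ fun x hx => ?_)
  rw [specialSum, Finset.sum_eq_single α]
  · exact (Set.indicator_of_mem hx _).symm
  · intro β _ hβ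
    exact Set.indicator_of_notMem (fun h => hβ (eq_of_mem_rowInterval hS (ε := 0) h hx)) _
  · simp

/-- Bounds for Birkhoff sums and values along an orbit, at the scale given by level `k`. -/
lemma IsFDCAccel.exists_level_bounds {T : IET A d} (hT : T.Pos) (hK : T.Keane) {lam : ℕ → ℝ}
    {E : ℤ → Submodule ℝ (A → ℝ)} {τ : ℝ} (hτ : 0 < τ) {n : ℕ → ℕ}
    (h : T.IsFDCAccel lam E τ n) {b K K' : ℝ} (hb : 0 < b) (hb1 : b < 1) (hK0 : 0 ≤ K)
    (hK' : 0 ≤ K') {φ ψ : ℝ → ℝ} (hφ : T.HasDerivBound b K φ)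
    (hψ : ∀ α, ∀ x ∈ Set.Ioo (T.l α) (T.r α), |ψ x| ≤ K' * endWeight b (T.l α) (T.r α) x)
    (hgrowth : (fun k : ℕ => vnorm ((T.acc n k).meanProj (T.specialSum n k φ)))
      =O[atTop] fun k : ℕ => Real.exp (b * lam 1 * (1 + τ) * k)) :
    ∃ c₂ C₃ : ℝ, 0 < c₂ ∧ c₂ ≤ 1 ∧ 0 ≤ C₃ ∧ ∀ k : ℕ, 1 ≤ k → ∀ x ∈ T.base,
      (∀ t < ⌈c₂ * Real.exp (lam 1 * k)⌉₊, ∀ j ≤ k,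
        T.map^[t] x ∉ (T.acc n j).nearEnds (Real.exp (-(lam 1 * (1 + τ) * k)))) →
      ∀ m : ℕ, (m : ℝ) < c₂ * Real.exp (lam 1 * k) →
        |birkhoffSum T.map φ m x| ≤ C₃ * Real.exp ((2 * τ + b * lam 1 * (1 + τ)) * k) ∧
        |ψ (T.map^[m] x)| ≤ C₃ * Real.exp ((2 * τ + b * lam 1 * (1 + τ)) * k) := by
  have hL := h.lam_one_pos hT hK hτ
  obtain ⟨hn, c, C, κ, δ, hc, hC, hκ, hδ, hδ1, ρ, U, -, -, hR, hB⟩ := h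
  set L := lam 1 with hLdef
  obtain ⟨M, hM0, hM⟩ := bound_of_isBigO_nat_atTop hgrowth
  have htot := total_pos hT
  set c₁ := T.total / (κ * C) with hc₁
  have hc₁0 : 0 < c₁ := by positivity
  set D := Fintype.card A * K * zetaSum (1 + b) / b with hD
  have hD0 : 0 ≤ D := div_nonneg
    (mul_nonneg (mul_nonneg (Nat.cast_nonneg _) hK0) (zetaSum_nonneg _)) hb.le
  have h1b : 0 < 1 - b := by linarith
  -- The contributions are the mean value (`M`), the distance to the ends (`2`) and the length of
  -- the interval (`c₁`).
  set B := M + D * (2 + 2 / (1 - b) * c₁ ^ (-b)) with hBdef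
  have hB0 : 0 ≤ B := by positivity
  have hexp_b : ∀ s : ℝ, Real.exp (-(L * (1 + τ) * s)) ^ (-b) = Real.exp (b * L * (1 + τ) * s) := by
    intro s
    rw [← Real.exp_mul]
    ring_nf
  have hpow : ∀ {j k : ℕ}, j ≤ k → ∀ {s : ℝ}, 0 ≤ s → Real.exp (s * j) ≤ Real.exp (s * k) := by
    intro j k hjk s hs
    rw [Real.exp_le_exp]
    exact mul_le_mul_of_nonneg_left (by exact_mod_cast hjk) hs
  have hs0 : 0 ≤ b * L * (1 + τ) := by positivity
  have hspecial : ∀ j k : ℕ, j ≤ k → ∀ α, ∀ y ∈ (T.acc n j).interval α,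
      y ∉ (T.acc n j).nearEnds (Real.exp (-(L * (1 + τ) * k))) →
      |birkhoffSum T.map φ (T.height n j α) y| ≤ B * Real.exp (b * L * (1 + τ) * k) := by
    intro j k hjk α y hy hy'
    have hS := acc_pos hT hK n j
    obtain ⟨hIoo, hg1, hg2⟩ := gaps_of_notMem_nearEnds (Real.exp_pos _) hy hy'
    have e1 := (isTower_acc hT hK hn j).abs_birkhoffSum_le_meanProj hT hS hb hb1 hK0 hφ hIoo
    rw [average_birkhoffSum_eq_meanProj n j hS] at e1
    have e2 : |(T.acc n j).meanProj (T.specialSum n j φ) α| ≤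
        M * Real.exp (b * L * (1 + τ) * k) := by
      calc |(T.acc n j).meanProj (T.specialSum n j φ) α|
          ≤ vnorm ((T.acc n j).meanProj (T.specialSum n j φ)) :=
            Finset.single_le_sum (f := fun α => |(T.acc n j).meanProj (T.specialSum n j φ) α|)
              (fun β _ => abs_nonneg _) (Finset.mem_univ α)
        _ ≤ M * Real.exp (b * L * (1 + τ) * j) := by
            have := hM (Real.exp_pos (b * L * (1 + τ) * j)).ne'
            rw [Real.norm_eq_abs, Real.norm_eq_abs, abs_of_pos (Real.exp_pos _)] at this
            exact (le_abs_self _).trans this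
        _ ≤ _ := mul_le_mul_of_nonneg_left (hpow hjk hs0) hM0.le
    have e3 := endWeight_le hb (Real.exp_pos _) hg1 hg2
    rw [hexp_b] at e3
    have e4 : (T.acc n j).len α ^ (-b) ≤ c₁ ^ (-b) * Real.exp (b * L * (1 + τ) * k) := by
      calc (T.acc n j).len α ^ (-b)
          ≤ (c₁ * Real.exp (-(L * (1 + τ) * j))) ^ (-b) :=
            Real.rpow_le_rpow_of_nonpos (by positivity) (hB.le_len hT hK hn hC hκ j α)
              (by linarith)
        _ = c₁ ^ (-b) * Real.exp (b * L * (1 + τ) * j) := by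
            rw [Real.mul_rpow hc₁0.le (Real.exp_pos _).le, hexp_b]
        _ ≤ _ := mul_le_mul_of_nonneg_left (hpow hjk hs0) (by positivity)
    have e5 : 2 / (1 - b) * (T.acc n j).len α ^ (-b) ≤
        2 / (1 - b) * (c₁ ^ (-b) * Real.exp (b * L * (1 + τ) * k)) :=
      mul_le_mul_of_nonneg_left e4 (by positivity)
    have e6 := mul_le_mul_of_nonneg_left (add_le_add e3 e5) hD0
    calc _ ≤ M * Real.exp (b * L * (1 + τ) * k) + D * (2 * Real.exp (b * L * (1 + τ) * k) +
          2 / (1 - b) * (c₁ ^ (-b) * Real.exp (b * L * (1 + τ) * k))) :=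
            e1.trans (add_le_add e2 e6)
      _ = _ := by rw [hBdef]; ring
  -- The first entry of the minimum keeps `m` below all heights of level `k`; the bound by `1`
  -- serves the later summability. In `C₃`, the first term is for the Birkhoff sum, where $k\le
  -- e^{\tau k}/\tau$ absorbs the number of levels, and `2 * K'` is for `ψ`.
  refine ⟨min (δ * c / κ) 1, 2 * C * B / τ + 2 * K', by positivity, min_le_right _ _,
    by positivity, ?_⟩
  intro k hk x hx hgood m hm
  have hmN : m < ⌈min (δ * c / κ) 1 * Real.exp (L * k)⌉₊ := Nat.lt_ceil.2 hm
  set X := Real.exp (b * L * (1 + τ) * k) with hX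
  have hX0 : 0 < X := Real.exp_pos _
  have hXexp : Real.exp ((2 * τ + b * L * (1 + τ)) * k) =
      Real.exp (τ * k) * Real.exp (τ * k) * X := by
    rw [← Real.exp_add, ← Real.exp_add]
    ring_nf
  have hY1 : 1 ≤ Real.exp (τ * k) := Real.one_le_exp (by positivity)
  have hY2 : τ * k ≤ Real.exp (τ * k) := by linarith [Real.add_one_le_exp (τ * k)]
  set Y := Real.exp (τ * k) with hYdef
  rw [hXexp]
  constructor
  · have hheight : ∀ α, m < T.height n k α := by
      intro α
      have h1 := hB.le_height hT hK hn hκ hδ hR hk α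
      have h2 : min (δ * c / κ) 1 * Real.exp (L * k) ≤ δ * c / κ * Real.exp (L * k) :=
        mul_le_mul_of_nonneg_right (min_le_left _ _) (Real.exp_pos _).le
      exact_mod_cast hm.trans_le (h2.trans h1)
    have hZ : ∀ j < k, ∀ α, ((∑ β, T.Zsucc n j α β : ℕ) : ℝ) ≤ C * Y := by
      intro j hj α
      refine (row_sum_le_mnorm _ α).trans ((hB.bound_Z j).trans ?_)
      exact mul_le_mul_of_nonneg_left (hpow hj.le hτ.le) (by linarith)
    have hx0 : x ∈ (T.acc n 0).base := by rwa [acc_zero hn]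
    have hx1 : T.map^[m] x ∈ (T.acc n 0).base := by
      rw [acc_zero hn]
      exact iterate_mem_base hT m hx
    have key := abs_birkhoffSum_le_of_isTower (acc_pos hT hK n) (isTower_acc hT hK hn)
      (isTower_acc_succ hT hK hn) hZ (φ := φ) (B := B * X) (by positivity) k 0 (zero_add k) m
      hheight x hx0 hx1
      (fun i hi t ht α hα => hspecial i k hi.le α _ hα (hgood t (ht.trans hmN) i hi.le))
    refine key.trans ?_
    have e1 : (k : ℝ) ≤ Y / τ := by
      rw [le_div_iff₀ hτ]
      linarith
    calc (k : ℝ) * (2 * (C * Y * (B * X))) ≤ Y / τ * (2 * (C * Y * (B * X))) :=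
          mul_le_mul_of_nonneg_right e1 (by positivity)
      _ = 2 * C * B / τ * (Y * Y * X) := by ring
      _ ≤ (2 * C * B / τ + 2 * K') * (Y * Y * X) :=
          mul_le_mul_of_nonneg_right (by linarith) (by positivity)
  · obtain ⟨α, hα⟩ := T.exists_mem_rowInterval 0 (iterate_mem_base hT m hx)
    -- Level `0` is `T` itself, so the orbit also avoids the singularities of `ψ`.
    have hg := hgood m hmN 0 (Nat.zero_le _)
    rw [acc_zero hn] at hg
    obtain ⟨hIoo, hg1, hg2⟩ := gaps_of_notMem_nearEnds (Real.exp_pos _) hα hg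
    have e3 := endWeight_le hb (Real.exp_pos _) hg1 hg2
    rw [hexp_b] at e3
    have e4 : 1 ≤ Y * Y := by nlinarith
    have e5 : 0 ≤ 2 * C * B / τ := by positivity
    calc |ψ (T.map^[m] x)| ≤ K' * (2 * X) :=
          (hψ α _ hIoo).trans (mul_le_mul_of_nonneg_left e3 hK')
      _ = 2 * K' * (1 * X) := by ring
      _ ≤ (2 * C * B / τ + 2 * K') * (Y * Y * X) := by
          refine mul_le_mul (by linarith) (mul_le_mul_of_nonneg_right e4 hX0.le) (by positivity)
            (by positivity)

/-- The extra factor `1 + τ` in the scale leaves $(k+1)e^{-L\tau k}$. -/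
lemma summable_card_mul_scale {L τ c₂ : ℝ} (hL : 0 < L) (hτ : 0 < τ) (hc0 : 0 < c₂)
    (hc1 : c₂ ≤ 1) : Summable fun k : ℕ => (⌈c₂ * Real.exp (L * k)⌉₊ : ℝ) *
      ((k + 1 : ℝ) * Real.exp (-(L * (1 + τ) * k))) := by
  have hr : Real.exp (-(L * τ)) < 1 := by
    rw [Real.exp_lt_one_iff]
    have := mul_pos hL hτ
    linarith
  have hr0 := Real.exp_pos (-(L * τ))
  have hs1 := summable_pow_mul_geometric_of_norm_lt_one 1
    (show ‖Real.exp (-(L * τ))‖ < 1 by rwa [Real.norm_eq_abs, abs_of_pos hr0])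
  have hs2 := summable_geometric_of_lt_one hr0.le hr
  refine Summable.of_nonneg_of_le (fun k => by positivity) (fun k => ?_)
    ((hs1.add hs2).mul_left 2)
  have e1 : (⌈c₂ * Real.exp (L * k)⌉₊ : ℝ) ≤ 2 * Real.exp (L * k) := by
    have h1 := Nat.ceil_lt_add_one (a := c₂ * Real.exp (L * k)) (by positivity)
    have h2 : 1 ≤ Real.exp (L * k) := Real.one_le_exp (by positivity)
    nlinarith
  have e2 : Real.exp (-(L * τ)) ^ k = Real.exp (L * k) * Real.exp (-(L * (1 + τ) * k)) := by
    rw [← Real.exp_nat_mul, ← Real.exp_add]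
    ring_nf
  rw [pow_one, e2]
  refine (mul_le_mul_of_nonneg_right e1 (by positivity)).trans (le_of_eq ?_)
  ring

/-- Under the growth condition on mean values, Birkhoff sums along almost every orbit grow at most
like a power of the time with exponent arbitrarily close to `b`. -/
lemma SatisfiesFDC.ae_exists_bound {T : IET A d} {lam : ℕ → ℝ} {E : ℤ → Submodule ℝ (A → ℝ)}
    (hT : T.SatisfiesFDC lam E) {b K K' : ℝ} (hb : 0 < b) (hb1 : b < 1) (hK0 : 0 ≤ K)
    (hK' : 0 ≤ K') {φ ψ : ℝ → ℝ} (hφ : T.HasDerivBound b K φ)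
    (hψ : ∀ α, ∀ x ∈ Set.Ioo (T.l α) (T.r α), |ψ x| ≤ K' * endWeight b (T.l α) (T.r α) x)
    (hgrowth : ∀ τ : ℝ, 0 < τ → ∃ n : ℕ → ℕ, T.IsFDCAccel lam E τ n ∧
      (fun k : ℕ => vnorm ((T.acc n k).meanProj (T.specialSum n k φ)))
        =O[atTop] fun k : ℕ => Real.exp (b * lam 1 * (1 + τ) * k))
    {ε : ℝ} (hε : 0 < ε) :
    ∀ᵐ x ∂(volume.restrict T.base), ∃ C : ℝ, 0 ≤ C ∧ ∀ m : ℕ,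
      |birkhoffSum T.map φ m x| ≤ C * (m + 1 : ℝ) ^ (b + ε) ∧
      |ψ (T.map^[m] x)| ≤ C * (m + 1 : ℝ) ^ (b + ε) := by
  have hL : 0 < lam 1 := by
    obtain ⟨n, hn, -⟩ := hgrowth 1 one_pos
    exact hn.lam_one_pos hT.pos hT.keane one_pos
  set L := lam 1 with hLdef
  -- The solution of `2 * τ + b * L * (1 + τ) = L * (b + ε)`.
  set τ := L * ε / (2 + b * L) with hτdef
  have hτ : 0 < τ := by positivity
  have hexp : 2 * τ + b * L * (1 + τ) = L * (b + ε) := by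
    rw [hτdef]
    field_simp
    ring
  obtain ⟨n, hacc, hO⟩ := hgrowth τ hτ
  obtain ⟨c₂, C₃, hc0, hc1, hC₃, hlevel⟩ :=
    hacc.exists_level_bounds hT.pos hT.keane hτ hb hb1 hK0 hK' hφ hψ hO
  have hae := ae_eventually_notMem_nearEnds hT.pos (T.acc n)
    (fun k => ⌈c₂ * Real.exp (L * k)⌉₊) (fun k => Real.exp (-(L * (1 + τ) * k)))
    (fun k => (Real.exp_pos _).le) (summable_card_mul_scale hL hτ hc0 hc1)
  filter_upwards [hae, ae_restrict_mem measurableSet_Ico] with x hx hxbase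
  obtain ⟨k₀, hk₀⟩ := eventually_atTop.1 hx
  set k₁ := k₀ + 1 with hk₁
  set C₅ := Real.exp (L * k₁) * (Real.exp L / c₂) with hC₅
  have hC₅0 : 0 < C₅ := by positivity
  refine ⟨C₃ * C₅ ^ (b + ε), by positivity, fun m => ?_⟩
  -- The real level at which `c₂ * exp (L * y) = m + 1`. It is rounded up and shifted by `k₁`, past
  -- the exceptional levels of `x`; `C₅` pays for both changes, so all `m` share one constant.
  set y := Real.log ((m + 1) / c₂) / L with hy
  have hm1 : (0 : ℝ) < m + 1 := by positivity
  have hyL : Real.exp (L * y) = (m + 1) / c₂ := by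
    rw [hy, mul_div_cancel₀ _ hL.ne', Real.exp_log (by positivity)]
  have hy0 : 0 ≤ y := by
    refine div_nonneg (Real.log_nonneg ?_) hL.le
    rw [one_le_div hc0]
    have : (0 : ℝ) ≤ m := Nat.cast_nonneg m
    linarith
  set k := k₁ + ⌈y⌉₊ with hk
  have hexpk : Real.exp (L * k) = Real.exp (L * k₁) * Real.exp (L * ⌈y⌉₊) := by
    rw [← Real.exp_add, hk]
    push_cast
    ring_nf
  have hlow : (m + 1) / c₂ ≤ Real.exp (L * k) := by
    rw [← hyL, Real.exp_le_exp]
    refine mul_le_mul_of_nonneg_left ((Nat.le_ceil y).trans ?_) hL.le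
    rw [hk]
    push_cast
    have : (0 : ℝ) ≤ k₁ := Nat.cast_nonneg _
    linarith
  have hupp : Real.exp (L * k) ≤ C₅ * (m + 1) := by
    have h1 : Real.exp (L * ⌈y⌉₊) ≤ Real.exp L * ((m + 1) / c₂) := by
      rw [← hyL, ← Real.exp_add, Real.exp_le_exp]
      have := Nat.ceil_lt_add_one hy0
      nlinarith
    rw [hexpk, hC₅]
    refine (mul_le_mul_of_nonneg_left h1 (Real.exp_pos _).le).trans (le_of_eq ?_)
    ring
  have hm : (m : ℝ) < c₂ * Real.exp (L * k) := by
    rw [div_le_iff₀ hc0] at hlow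
    linarith
  have hfinal : C₃ * Real.exp ((2 * τ + b * L * (1 + τ)) * k) ≤
      C₃ * C₅ ^ (b + ε) * (m + 1 : ℝ) ^ (b + ε) := by
    rw [hexp, mul_assoc C₃, ← Real.mul_rpow hC₅0.le hm1.le]
    refine mul_le_mul_of_nonneg_left ?_ hC₃
    rw [show L * (b + ε) * k = L * k * (b + ε) by ring, Real.exp_mul]
    exact Real.rpow_le_rpow (Real.exp_pos _).le hupp (by positivity)
  obtain ⟨h1, h2⟩ := hlevel k (by omega) x hxbase (hk₀ k (by omega)) m hm
  exact ⟨h1.trans hfinal, h2.trans hfinal⟩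

/-! ### Integrals along special flows -/

lemma fiber_eq_Ico {g : ℝ → ENNReal} {x : ℝ} (hx : g x ≠ ⊤) :
    fiber g x = Set.Ico 0 (g x).toReal := by
  ext v
  simp only [fiber, Set.mem_ofPred_eq, Set.mem_Ico]
  exact and_congr_right fun hv => ENNReal.ofReal_lt_iff_lt_toReal hv hx

section orbit

variable {T : IET A d} {g : ℝ → ENNReal} {x : ℝ}

lemma birkhoffSum_ne_top (hg : ∀ i, g (T.map^[i] x) ≠ ⊤) (N : ℕ) :
    birkhoffSum T.map g N x ≠ ⊤ :=
  ENNReal.sum_ne_top.2 fun i _ => hg i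

lemma toReal_birkhoffSum_succ (hg : ∀ i, g (T.map^[i] x) ≠ ⊤) (N : ℕ) :
    (birkhoffSum T.map g (N + 1) x).toReal =
      (birkhoffSum T.map g N x).toReal + (g (T.map^[N] x)).toReal := by
  rw [birkhoffSum_succ, ENNReal.toReal_add (birkhoffSum_ne_top hg N) (hg N)]

lemma toReal_birkhoffSum_mono (hg : ∀ i, g (T.map^[i] x) ≠ ⊤) :
    Monotone fun N => (birkhoffSum T.map g N x).toReal :=
  monotone_nat_of_le_succ fun N => by
    rw [toReal_birkhoffSum_succ hg]
    exact le_add_of_nonneg_right ENNReal.toReal_nonneg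

lemma mul_le_toReal_birkhoffSum (hg : ∀ i, g (T.map^[i] x) ≠ ⊤) {γ : ℝ}
    (hγ : ∀ i, γ ≤ (g (T.map^[i] x)).toReal) (N : ℕ) :
    N * γ ≤ (birkhoffSum T.map g N x).toReal := by
  induction N with
  | zero => simp
  | succ N ih =>
    rw [toReal_birkhoffSum_succ hg]
    push_cast
    linarith [hγ N]

lemma crossings_eq (hg : ∀ i, g (T.map^[i] x) ≠ ⊤) {v : ℝ} (hv : 0 ≤ v) {N : ℕ}
    (h1 : (birkhoffSum T.map g N x).toReal ≤ v)
    (h2 : v < (birkhoffSum T.map g (N + 1) x).toReal) : T.crossings g x v = N := by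
  refine IsLeast.csInf_eq ⟨?_, fun M hM => ?_⟩
  · exact (ENNReal.ofReal_lt_iff_lt_toReal hv (birkhoffSum_ne_top hg _)).2 h2
  · have hM' := (ENNReal.ofReal_lt_iff_lt_toReal hv (birkhoffSum_ne_top hg _)).1 hM
    by_contra hlt
    exact absurd (toReal_birkhoffSum_mono hg (show M + 1 ≤ N by omega))
      (not_le.2 (h1.trans_lt hM'))

lemma exists_crossing (hg : ∀ i, g (T.map^[i] x) ≠ ⊤) {γ : ℝ} (hγ0 : 0 < γ)
    (hγ : ∀ i, γ ≤ (g (T.map^[i] x)).toReal) {v : ℝ} (hv : 0 ≤ v) :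
    ∃ N, (birkhoffSum T.map g N x).toReal ≤ v ∧
      v < (birkhoffSum T.map g (N + 1) x).toReal := by
  classical
  have hex : ∃ N, v < (birkhoffSum T.map g (N + 1) x).toReal := by
    obtain ⟨N, hN⟩ := exists_nat_gt (v / γ)
    refine ⟨N, lt_of_lt_of_le ?_ (mul_le_toReal_birkhoffSum hg hγ (N + 1))⟩
    rw [div_lt_iff₀ hγ0] at hN
    push_cast
    linarith
  refine ⟨Nat.find hex, ?_, Nat.find_spec hex⟩
  rcases hN : Nat.find hex with _ | M
  · simpa using hv
  · exact not_lt.1 (Nat.find_min hex (show M < Nat.find hex by omega))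

/-- The values of `f` along the upward trajectory over `x`, parametrized from the base. -/
def orbitFun (T : IET A d) (g : ℝ → ENNReal) (f : ℝ × ℝ → ℝ) (x u : ℝ) : ℝ :=
  f (T.map^[T.crossings g x u] x,
    u - (birkhoffSum T.map g (T.crossings g x u) x).toReal)

lemma orbitFun_eq (hg : ∀ i, g (T.map^[i] x) ≠ ⊤) (f : ℝ × ℝ → ℝ) {N : ℕ} {u : ℝ}
    (hu : u ∈ Set.Ico (birkhoffSum T.map g N x).toReal
      (birkhoffSum T.map g (N + 1) x).toReal) :
    T.orbitFun g f x u = f (T.map^[N] x, u - (birkhoffSum T.map g N x).toReal) := by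
  rw [orbitFun, crossings_eq hg (ENNReal.toReal_nonneg.trans hu.1) hu.1 hu.2]

variable {f : ℝ × ℝ → ℝ}

lemma intervalIntegrable_orbitFun_piece (hg : ∀ i, g (T.map^[i] x) ≠ ⊤)
    (hf : ∀ i, IntegrableOn (fun v => f (T.map^[i] x, v)) (fiber g (T.map^[i] x))) (N : ℕ) :
    IntervalIntegrable (T.orbitFun g f x) volume (birkhoffSum T.map g N x).toReal
      (birkhoffSum T.map g (N + 1) x).toReal := by
  have hle : (birkhoffSum T.map g N x).toReal ≤ (birkhoffSum T.map g (N + 1) x).toReal :=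
    toReal_birkhoffSum_mono hg (Nat.le_succ N)
  have h1 := hf N
  rw [fiber_eq_Ico (hg N), ← intervalIntegrable_iff_integrableOn_Ico_of_le
    ENNReal.toReal_nonneg] at h1
  have h2 := h1.comp_sub_right (birkhoffSum T.map g N x).toReal
  rw [zero_add, add_comm, ← toReal_birkhoffSum_succ hg,
    intervalIntegrable_iff_integrableOn_Ico_of_le hle] at h2
  rw [intervalIntegrable_iff_integrableOn_Ico_of_le hle]
  exact h2.congr_fun (fun u hu => (orbitFun_eq hg f hu).symm) measurableSet_Ico

/-- Between consecutive returns the trajectory is one full fibre. `H` is the identity for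
$\varphi_f$ and the absolute value for $\varphi_{|f|}$. -/
lemma integral_orbitFun_piece (hg : ∀ i, g (T.map^[i] x) ≠ ⊤) (H : ℝ → ℝ) (N : ℕ) :
    ∫ u in (birkhoffSum T.map g N x).toReal..(birkhoffSum T.map g (N + 1) x).toReal,
      H (T.orbitFun g f x u) = ∫ v in fiber g (T.map^[N] x), H (f (T.map^[N] x, v)) := by
  have hle : (birkhoffSum T.map g N x).toReal ≤ (birkhoffSum T.map g (N + 1) x).toReal :=
    toReal_birkhoffSum_mono hg (Nat.le_succ N)
  rw [intervalIntegral.integral_of_le hle, ← integral_Ico_eq_integral_Ioc,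
    setIntegral_congr_fun measurableSet_Ico
      (fun u hu => congrArg H (orbitFun_eq hg f hu)), integral_Ico_eq_integral_Ioc,
    ← intervalIntegral.integral_of_le hle,
    intervalIntegral.integral_comp_sub_right (fun v => H (f (T.map^[N] x, v))),
    toReal_birkhoffSum_succ hg, sub_self, add_sub_cancel_left,
    intervalIntegral.integral_of_le ENNReal.toReal_nonneg, ← integral_Ico_eq_integral_Ioc,
    fiber_eq_Ico (hg N)]

lemma toReal_fiberAbsInt {y : ℝ} (hf : IntegrableOn (fun v => f (y, v)) (fiber g y)) :
    (fiberAbsInt g f y).toReal = ∫ v in fiber g y, |f (y, v)| := by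
  rw [fiberAbsInt, ← ofReal_integral_eq_lintegral_ofReal hf.abs (ae_of_all _ fun _ => abs_nonneg _),
    ENNReal.toReal_ofReal (integral_nonneg fun _ => abs_nonneg _)]

lemma intervalIntegrable_orbitFun (hg : ∀ i, g (T.map^[i] x) ≠ ⊤) {γ : ℝ} (hγ0 : 0 < γ)
    (hγ : ∀ i, γ ≤ (g (T.map^[i] x)).toReal)
    (hf : ∀ i, IntegrableOn (fun v => f (T.map^[i] x, v)) (fiber g (T.map^[i] x)))
    {v : ℝ} (hv : 0 ≤ v) : IntervalIntegrable (T.orbitFun g f x) volume 0 v := by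
  obtain ⟨N, -, hN⟩ := exists_crossing hg hγ0 hγ hv
  have := IntervalIntegrable.trans_iterate (n := N + 1)
    fun k _ => intervalIntegrable_orbitFun_piece hg hf k
  simp only [birkhoffSum_zero, ENNReal.toReal_zero] at this
  refine this.mono_set ?_
  rw [Set.uIcc_of_le hv, Set.uIcc_of_le (hv.trans hN.le)]
  exact Set.Icc_subset_Icc_right hN.le

/-- Complete fibres add up to a Birkhoff sum of $\varphi_f$. On the incomplete last one cancellation
in $f$ may fail, hence the term with $|f|$. -/
lemma abs_integral_orbitFun_le (hg : ∀ i, g (T.map^[i] x) ≠ ⊤) {γ : ℝ} (hγ0 : 0 < γ)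
    (hγ : ∀ i, γ ≤ (g (T.map^[i] x)).toReal)
    (hf : ∀ i, IntegrableOn (fun v => f (T.map^[i] x, v)) (fiber g (T.map^[i] x)))
    {v : ℝ} (hv : 0 ≤ v) : ∃ N : ℕ, N * γ ≤ v ∧ |∫ u in (0 : ℝ)..v, T.orbitFun g f x u| ≤
      |birkhoffSum T.map (fiberInt g f) N x| + (fiberAbsInt g f (T.map^[N] x)).toReal := by
  obtain ⟨N, hN1, hN2⟩ := exists_crossing hg hγ0 hγ hv
  refine ⟨N, (mul_le_toReal_birkhoffSum hg hγ N).trans hN1, ?_⟩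
  have hpiece := intervalIntegrable_orbitFun_piece hg hf
  have hint := fun {v} => intervalIntegrable_orbitFun hg hγ0 hγ hf (v := v)
  set s := (birkhoffSum T.map g N x).toReal with hs
  have hs0 : 0 ≤ s := ENNReal.toReal_nonneg
  have e1 : ∫ u in (0 : ℝ)..s, T.orbitFun g f x u = birkhoffSum T.map (fiberInt g f) N x := by
    have := intervalIntegral.sum_integral_adjacent_intervals (n := N) fun k _ => hpiece k
    simp only [birkhoffSum_zero, ENNReal.toReal_zero] at this
    rw [hs, ← this, birkhoffSum]
    exact Finset.sum_congr rfl fun i _ => integral_orbitFun_piece hg id i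
  have hsub : IntervalIntegrable (T.orbitFun g f x) volume s v := (hint hs0).symm.trans (hint hv)
  have e2 : |∫ u in s..v, T.orbitFun g f x u| ≤ (fiberAbsInt g f (T.map^[N] x)).toReal := by
    rw [toReal_fiberAbsInt (hf N), ← integral_orbitFun_piece hg (fun t => |t|) N]
    refine (intervalIntegral.abs_integral_le_integral_abs hN1).trans ?_
    exact intervalIntegral.integral_mono_interval le_rfl hN1 hN2.le
      (ae_of_all _ fun _ => abs_nonneg _) (hpiece N).abs
  rw [← intervalIntegral.integral_add_adjacent_intervals (hint hs0) hsub, e1]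
  exact (abs_add_le _ _).trans (by gcongr)

lemma apply_flow_eq (t v : ℝ) : f (T.flow g t (x, v)) = T.orbitFun g f x (v + t) := rfl

/-- The trajectory of `(x, v)` is that of `(x, 0)` started at time `v`; the integral over `[0, v]`
is the constant `M`. -/
lemma flow_integral_bounds (hg : ∀ i, g (T.map^[i] x) ≠ ⊤) {γ : ℝ} (hγ0 : 0 < γ)
    (hγ : ∀ i, γ ≤ (g (T.map^[i] x)).toReal)
    (hf : ∀ i, IntegrableOn (fun v => f (T.map^[i] x, v)) (fiber g (T.map^[i] x)))
    {v : ℝ} (hv : 0 ≤ v) :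
    (∀ s : ℝ, 0 ≤ s → IntervalIntegrable (fun t => f (T.flow g t (x, v))) volume 0 s) ∧
      ∃ M : ℝ, 0 ≤ M ∧ ∀ s : ℝ, 0 ≤ s → ∃ N : ℕ, N * γ ≤ v + s ∧
        |∫ t in (0 : ℝ)..s, f (T.flow g t (x, v))| ≤ M +
          (|birkhoffSum T.map (fiberInt g f) N x| + (fiberAbsInt g f (T.map^[N] x)).toReal) := by
  have hint := fun {v} => intervalIntegrable_orbitFun hg hγ0 hγ hf (v := v)
  simp only [apply_flow_eq]
  refine ⟨fun s hs => ?_, |∫ u in (0 : ℝ)..v, T.orbitFun g f x u|, abs_nonneg _, fun s hs => ?_⟩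
  · have := ((hint hv).symm.trans (hint (add_nonneg hv hs))).comp_add_left v
    simpa using this
  · obtain ⟨N, hN, hN'⟩ := abs_integral_orbitFun_le hg hγ0 hγ hf (add_nonneg hv hs)
    refine ⟨N, hN, ?_⟩
    rw [intervalIntegral.integral_comp_add_left (fun u => T.orbitFun g f x u), add_zero,
      ← intervalIntegral.integral_interval_sub_left (hint (add_nonneg hv hs)) (hint hv)]
    refine (abs_sub _ _).trans ?_
    rw [add_comm]
    gcongr

end orbit

/-! ### Fibers of the special flow -/

lemma ae_mem_Ioo {T : IET A d} :
    ∀ᵐ x ∂(volume : Measure ℝ), x ∈ T.base → ∃ α, x ∈ Set.Ioo (T.l α) (T.r α) := by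
  have : ∀ᵐ x ∂(volume : Measure ℝ), ∀ α, x ≠ T.l α := by
    rw [ae_all_iff]
    exact fun α => by simp [ae_iff]
  filter_upwards [this] with x hx hxb
  obtain ⟨α, hα⟩ := T.exists_mem_rowInterval 0 hxb
  exact ⟨α, lt_of_le_of_ne hα.1 (hx α).symm, hα.2⟩

lemma ae_iterate {T : IET A d} (hT : T.Pos) {P : ℝ → Prop}
    (hP : ∀ᵐ x ∂(volume.restrict T.base), P x) :
    ∀ᵐ x ∂(volume.restrict T.base), ∀ i : ℕ, P (T.map^[i] x) :=
  ae_all_iff.2 fun i => ((measurePreserving_map hT).iterate i).quasiMeasurePreserving.ae hP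

/-- The part of the phase space over the interior of the interval `α`. -/
def suspensionOver (T : IET A d) (g : ℝ → ENNReal) (α : A) : Set (ℝ × ℝ) :=
  {p | p.1 ∈ Set.Ioo (T.l α) (T.r α) ∧ p.2 ∈ fiber g p.1}

lemma measurableSet_suspensionOver {T : IET A d} {g : ℝ → ENNReal} {α : A}
    (hfin : T.FiniteInside g)
    (hg : ContinuousOn (fun x => (g x).toReal) (Set.Ioo (T.l α) (T.r α))) :
    MeasurableSet (T.suspensionOver g α) := by
  classical
  set G : ℝ → ℝ := (Set.Ioo (T.l α) (T.r α)).piecewise (fun x => (g x).toReal) fun _ => 0 with hG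
  have hGm : Measurable G := hg.measurable_piecewise continuousOn_const measurableSet_Ioo
  have : T.suspensionOver g α =
      {p : ℝ × ℝ | p.1 ∈ Set.Ioo (T.l α) (T.r α)} ∩ ({p | 0 ≤ p.2} ∩ {p | p.2 < G p.1}) := by
    ext p
    simp only [suspensionOver, Set.mem_ofPred_eq, Set.mem_inter_iff]
    refine and_congr_right fun hp => ?_
    rw [fiber_eq_Ico (hfin α _ hp), hG, Set.piecewise_eq_of_mem _ _ _ hp]
    rfl
  rw [this]
  exact (measurable_fst measurableSet_Ioo).inter
    ((measurableSet_le measurable_const measurable_snd).inter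
      (measurableSet_lt measurable_snd (hGm.comp measurable_fst)))

lemma suspensionOver_subset {T : IET A d} (hT : T.Pos) (g : ℝ → ENNReal) (α : A) :
    T.suspensionOver g α ⊆ T.suspension g := fun _ hp =>
  ⟨rowInterval_subset_base hT 0 α (Set.Ioo_subset_Ico_self hp.1), hp.2⟩

/-- Only the fibres over the finitely many left ends are missing from the union of the
`suspensionOver` sets, and they form a null set. -/
lemma nullMeasurableSet_suspension {T : IET A d} (hT : T.Pos) {g : ℝ → ENNReal}
    (hm : ∀ α, MeasurableSet (T.suspensionOver g α)) : NullMeasurableSet (T.suspension g) := by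
  refine (MeasurableSet.iUnion hm).nullMeasurableSet.congr ?_
  have h : ∀ᵐ p : ℝ × ℝ, p.1 ∈ T.base → ∃ α, p.1 ∈ Set.Ioo (T.l α) (T.r α) :=
    Measure.quasiMeasurePreserving_fst.ae (ae_mem_Ioo (T := T))
  filter_upwards [h] with p hp
  refine propext ⟨fun h => ?_, fun h => ?_⟩
  · obtain ⟨α, hα⟩ := Set.mem_iUnion.1 h
    exact suspensionOver_subset hT g α hα
  · obtain ⟨α, hα⟩ := hp h.1
    exact Set.mem_iUnion.2 ⟨α, hα, h.2⟩

lemma ae_restrict_suspension {T : IET A d} (hT : T.Pos) {g : ℝ → ENNReal}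
    (hm : ∀ α, MeasurableSet (T.suspensionOver g α)) {P : ℝ → Prop}
    (hP : ∀ᵐ x ∂(volume.restrict T.base), P x) :
    ∀ᵐ p ∂(volume.restrict (T.suspension g)), p ∈ T.suspension g ∧ P p.1 := by
  have h : ∀ᵐ p : ℝ × ℝ, p.1 ∈ T.base → P p.1 :=
    Measure.quasiMeasurePreserving_fst.ae (p := fun x => x ∈ T.base → P x)
      ((ae_restrict_iff' measurableSet_Ico).1 hP)
  filter_upwards [ae_restrict_of_ae h, ae_restrict_mem₀ (nullMeasurableSet_suspension hT hm)]
    with p hp hps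
  exact ⟨hps, hp hps.1⟩

/-- Fubini for `f` cut off to the part over each interval. -/
lemma ae_integrableOn_fiber {T : IET A d} (hT : T.Pos) {g : ℝ → ENNReal} {f : ℝ × ℝ → ℝ}
    (hm : ∀ α, MeasurableSet (T.suspensionOver g α)) (hf : IntegrableOn f (T.suspension g)) :
    ∀ᵐ x ∂(volume : Measure ℝ), ∀ α, x ∈ Set.Ioo (T.l α) (T.r α) →
      IntegrableOn (fun v => f (x, v)) (fiber g x) := by
  rw [ae_all_iff]
  intro α
  have h1 : Integrable ((T.suspensionOver g α).indicator f) (volume.prod volume) :=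
    (integrable_indicator_iff (hm α)).2 (hf.mono_set (suspensionOver_subset hT g α))
  filter_upwards [h1.prod_right_ae] with x hx hxα
  have e : (fun v => (T.suspensionOver g α).indicator f (x, v)) =
      (fiber g x).indicator fun v => f (x, v) := by
    funext v
    by_cases hv : v ∈ fiber g x
    · rw [Set.indicator_of_mem hv, Set.indicator_of_mem (show (x, v) ∈ T.suspensionOver g α from
        ⟨hxα, hv⟩)]
    · rw [Set.indicator_of_notMem hv, Set.indicator_of_notMem fun h => hv h.2]
  rw [e] at hx
  refine (integrable_indicator_iff ?_).1 hx
  exact measurableSet_le measurable_const measurable_id |>.inter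
    (measurableSet_lt ENNReal.measurable_ofReal measurable_const)

/-! ### Growth exponents -/

lemma limsup_log_div_log_le {I : ℝ → ℝ} {b : ℝ}
    (h : ∀ ε : ℝ, 0 < ε → ∃ C : ℝ, ∀ s : ℝ, 1 ≤ s → |I s| ≤ C * s ^ (b + ε)) (hb : 0 < b) :
    limsup (fun s : ℝ => ((Real.log |I s| / Real.log s : ℝ) : EReal)) atTop ≤ (b : EReal) := by
  refine EReal.le_of_forall_lt_iff_le.1 fun z hz => ?_
  have hz' : b < z := by exact_mod_cast hz
  set ε := (z - b) / 2 with hε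
  have hε0 : 0 < ε := by linarith
  obtain ⟨C, hC⟩ := h ε hε0
  set C' := max C 1 with hC'
  have hC1 : 1 ≤ C' := le_max_right _ _
  refine limsup_le_of_le (by isBoundedDefault) ?_
  filter_upwards [eventually_gt_atTop 1, Real.tendsto_log_atTop.eventually_ge_atTop
    (Real.log C' / ε)] with s hs hs'
  have hs0 : 0 < s := by linarith
  have hlog : 0 < Real.log s := Real.log_pos hs
  rw [div_le_iff₀ hε0] at hs'
  have hlogC : 0 ≤ Real.log C' := Real.log_nonneg hC1
  have key : Real.log |I s| ≤ Real.log C' + (b + ε) * Real.log s := by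
    -- Since `Real.log 0 = 0`, a vanishing integral gives the quotient `0`; this is harmless because
    -- `b > 0`.
    by_cases h0 : |I s| = 0
    · rw [h0, Real.log_zero]
      positivity
    · have hle : |I s| ≤ C' * s ^ (b + ε) := (hC s hs.le).trans
        (mul_le_mul_of_nonneg_right (le_max_left _ _) (Real.rpow_nonneg hs0.le _))
      have := Real.log_le_log (lt_of_le_of_ne (abs_nonneg _) (Ne.symm h0)) hle
      rwa [Real.log_mul (by positivity) (Real.rpow_pos_of_pos hs0 _).ne', Real.log_rpow hs0] at this
  rw [EReal.coe_le_coe_iff, div_le_iff₀ hlog]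
  have : z = b + ε + ε := by rw [hε]; ring
  rw [this]
  linarith

end IET

end

/-! ### Growth of ergodic integrals of the special flow -/

theorem theorem7p8 {A : Type*} [Fintype A] [DecidableEq A] {d : ℕ} (T : IET A d)
    (lam : ℕ → ℝ) (E : ℤ → Submodule ℝ (A → ℝ)) (hT : T.SatisfiesFDC lam E)
    (a b : ℝ) (hb : 0 < b) (hba : b ≤ a) (ha : a < 1)
    (g : ℝ → ENNReal) (hg_inf : 0 < ⨅ x ∈ T.base, g x)
    (hg_fin : T.FiniteInside g) (hg : T.MemPG a (fun x => (g x).toReal))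
    (f : ℝ × ℝ → ℝ) (hf : IntegrableOn f (T.suspension g))
    (hφ : T.MemPG b (IET.fiberInt g f))
    (hφabs_fin : T.FiniteInside (IET.fiberAbsInt g f))
    (hφabs : T.MemPhat b (fun x => (IET.fiberAbsInt g f x).toReal))
    (hgrowth : ∀ τ : ℝ, 0 < τ → ∃ n : ℕ → ℕ, T.IsFDCAccel lam E τ n ∧
      (fun k : ℕ => IET.vnorm ((T.acc n k).meanProj (T.specialSum n k (IET.fiberInt g f))))
        =O[atTop] fun k : ℕ => Real.exp (b * lam 1 * (1 + τ) * k)) :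
    ∀ᵐ p ∂(volume.restrict (T.suspension g)),
      (∀ s : ℝ, 0 ≤ s → IntervalIntegrable (fun t => f (T.flow g t p)) volume 0 s) ∧
      limsup (fun s : ℝ =>
        ((Real.log |∫ t in (0 : ℝ)..s, f (T.flow g t p)| / Real.log s : ℝ) : EReal)) atTop
        ≤ (b : EReal) := by
  have hpos := hT.pos
  obtain ⟨K, hK0, hK⟩ := hφ.exists_hasDerivBound
  obtain ⟨-, K', hK'⟩ := hφabs
  have hψ : ∀ α, ∀ x ∈ Set.Ioo (T.l α) (T.r α), |(IET.fiberAbsInt g f x).toReal| ≤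
      |K'| * IET.endWeight b (T.l α) (T.r α) x := IET.exists_two_sided_bound hK'
  have hm : ∀ α, MeasurableSet (T.suspensionOver g α) := fun α =>
    IET.measurableSet_suspensionOver hg_fin (hg.1 α).continuousOn
  -- The acceleration and the null set depend on the exponent, so only the countably many values `ε
  -- = 1 / (j + 1)` are taken.
  have hgrow : ∀ᵐ x ∂(volume.restrict T.base), ∀ j : ℕ, ∃ C : ℝ, 0 ≤ C ∧ ∀ m : ℕ,
      |birkhoffSum T.map (IET.fiberInt g f) m x| ≤ C * (m + 1 : ℝ) ^ (b + 1 / ((j : ℝ) + 1)) ∧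
      |(IET.fiberAbsInt g f (T.map^[m] x)).toReal| ≤
        C * (m + 1 : ℝ) ^ (b + 1 / ((j : ℝ) + 1)) := by
    rw [ae_all_iff]
    intro j
    have hj : (0 : ℝ) < 1 / ((j : ℝ) + 1) := by positivity
    exact hT.ae_exists_bound (ψ := fun x => (IET.fiberAbsInt g f x).toReal) hb (hba.trans_lt ha)
      hK0 (abs_nonneg K') hK hψ hgrowth hj
  have hreg : ∀ᵐ y ∂(volume.restrict T.base), (∃ α, y ∈ Set.Ioo (T.l α) (T.r α)) ∧
      IntegrableOn (fun v => f (y, v)) (IET.fiber g y) := by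
    filter_upwards [ae_restrict_of_ae (IET.ae_mem_Ioo (T := T)),
      ae_restrict_of_ae (IET.ae_integrableOn_fiber hpos hm hf), ae_restrict_mem measurableSet_Ico]
      with y h1 h2 h3
    obtain ⟨α, hα⟩ := h1 h3
    exact ⟨⟨α, hα⟩, h2 α hα⟩
  filter_upwards [IET.ae_restrict_suspension hpos hm (hgrow.and (IET.ae_iterate hpos hreg))] with p hp
  obtain ⟨x, v⟩ := p
  obtain ⟨hps, hgr, hre⟩ := hp
  have hxb : x ∈ T.base := hps.1
  have hfin : ∀ i, g (T.map^[i] x) ≠ ⊤ := fun i => by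
    obtain ⟨α, hα⟩ := (hre i).1
    exact hg_fin α _ hα
  have hinf : ∀ i, ⨅ y ∈ T.base, g y ≤ g (T.map^[i] x) := fun i =>
    iInf₂_le _ (IET.iterate_mem_base hpos i hxb)
  have hinf_top : ⨅ y ∈ T.base, g y ≠ ⊤ := ne_top_of_le_ne_top (hfin 0) (hinf 0)
  set γ := (⨅ y ∈ T.base, g y).toReal with hγ
  have hγ0 : 0 < γ := ENNReal.toReal_pos hg_inf.ne' hinf_top
  have hv : 0 ≤ v := hps.2.1
  obtain ⟨hint, M, hM0, hM⟩ := IET.flow_integral_bounds hfin hγ0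
    (fun i => ENNReal.toReal_mono (hfin i) (hinf i)) (fun i => (hre i).2) hv
  refine ⟨hint, IET.limsup_log_div_log_le (fun ε hε => ?_) hb⟩
  obtain ⟨j, hj⟩ := exists_nat_one_div_lt hε
  obtain ⟨C, hC0, hC⟩ := hgr j
  set q := b + 1 / ((j : ℝ) + 1) with hq
  have hq0 : 0 < q := by positivity
  have hqε : q ≤ b + ε := by linarith
  -- For `s ≥ 1` the number of returns satisfies `N ≤ (v + s) / γ ≤ (v + 1) / γ * s`; the factor `2`
  -- covers the Birkhoff sum and the last fibre.
  refine ⟨M + 2 * C * ((v + 1) / γ + 1) ^ q, fun s hs => ?_⟩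
  have hs0 : 0 ≤ s := by linarith
  obtain ⟨N, hN, hNle⟩ := hM s hs0
  obtain ⟨h1, h2⟩ := hC N
  have hN' : (N : ℝ) + 1 ≤ ((v + 1) / γ + 1) * s := by
    have h3 : (N : ℝ) ≤ (v + 1) / γ * s := by
      rw [div_mul_eq_mul_div, le_div_iff₀ hγ0]
      nlinarith
    linarith
  have h4 : (N + 1 : ℝ) ^ q ≤ ((v + 1) / γ + 1) ^ q * s ^ (b + ε) := by
    refine (Real.rpow_le_rpow (by positivity) hN' hq0.le).trans ?_
    rw [Real.mul_rpow (by positivity) hs0]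
    exact mul_le_mul_of_nonneg_left (Real.rpow_le_rpow_of_exponent_le hs hqε) (by positivity)
  have h5 : 1 ≤ s ^ (b + ε) := Real.one_le_rpow hs (by positivity)
  have h6 := le_abs_self (IET.fiberAbsInt g f (T.map^[N] x)).toReal
  calc _ ≤ M * 1 + 2 * C * (N + 1 : ℝ) ^ q := by linarith
    _ ≤ M * s ^ (b + ε) + 2 * C * (((v + 1) / γ + 1) ^ q * s ^ (b + ε)) :=
      add_le_add (mul_le_mul_of_nonneg_left h5 hM0)
        (mul_le_mul_of_nonneg_left h4 (by positivity))
    _ = _ := by ring
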